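/- Let $T$ be a complete first-order theory (classical logic) in a countable single-sorted language, and assume that $T$ is $\aleph_0$-categorical, i.e. any two of its countable models are isomorphic. Let $M$ be a countable model of $T$, and assume that $M$ is not a singleton. Let $G(T)=\operatorname{Aut}(M)$, with the topology of pointwise convergence ($M$ being discrete). Let $\Phi=(\varphi_n(x_0,\dots,x_{n-1},y))_{n\in\mathbb N}$ be a rich sequence of formulas, i.e. every formula $\varphi(x_0,\dots,x_{k-1},y)$ appears in it, up to adding dummy variables, as $\varphi_n$ for some $n\ge k$. For a sequence $x=(x_n)_{n\in\mathbb N}$ let $$D_\Phi(x)=\bigwedge_{k\in\mathbb N}\forall y\,\bigl[\varphi_k(x_0,\dots,x_{k-1},y)\rightarrow\varphi_k(x_0,\dots,x_{k-1},x_k)\bigr].$$ Let $\mathbf G(T)=\mathbf G_\Phi(T)$ be the groupoid of all complete types $\operatorname{tp}(a,b)$, where $a,b\in N^{\mathbb N}$ are two enumerations (possibly with repetitions) of a same countable model $N$ of $T$, both satisfying $D_\Phi$. Its composition law is $\operatorname{tp}(a,b)\cdot\operatorname{tp}(b,c)=\operatorname{tp}(a,c)$, its inversion is $\operatorname{tp}(a,b)^{-1}=\operatorname{tp}(b,a)$,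 and its topology is the one induced from the space $S_{2\times\mathbb N}(T)$ of complete types. Let $2^{\mathbb N}\times G(T)\times 2^{\mathbb N}$ carry the product topology and the groupoid structure in which $(x,g,y)(y',f,z)$ is defined if and only if $y=y'$, and is then equal to $(x,gf,z)$. Then $\mathbf G(T)$ and $2^{\mathbb N}\times G(T)\times 2^{\mathbb N}$ are (Hausdorff) topological groupoids, and $$\mathbf G(T)\;\cong\;2^{\mathbb N}\times G(T)\times 2^{\mathbb N}$$ as topological groupoids, i.e. there is a homeomorphism between them under which a composition is defined if and only if the composition of the images is, and which respects composition. -/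

import Mathlib

open FirstOrder FirstOrder.Language

universe u v w

/-! ### Groupoids, as sets with a partial composition law -/

/-- A groupoid: a set with a partial composition law and an inversion map.  Equalities between
elements of `Part` say that one side is defined if and only if the other is, and that they agree. -/
class PartialGroupoid (G : Type*) where
  /-- the partial composition law -/
  pmul : G → G → Part G
  /-- inversion -/
  pinv : G → G
  assoc : ∀ f g h, (pmul f g).bind (fun k => pmul k h) = (pmul g h).bind (fun k => pmul f k)
  inv_mul_dom : ∀ g, (pmul (pinv g) g).Dom
  mul_inv_dom : ∀ g, (pmul g (pinv g)).Dom
  mul_inv_cancel : ∀ f g, (pmul f g).Dom → (pmul f g).bind (fun k => pmul k (pinv g)) = Part.some f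
  inv_mul_cancel : ∀ f g, (pmul f g).Dom →
    (pmul (pinv f) f).bind (fun k => pmul k g) = Part.some g

namespace PartialGroupoid

section

variable {G : Type*} [PartialGroupoid G]

/-- The source `g⁻¹ g`. -/
def src (g : G) : G := (pmul (pinv g) g).get (inv_mul_dom g)

/-- The target `g g⁻¹`. -/
def tgt (g : G) : G := (pmul g (pinv g)).get (mul_inv_dom g)

/-- The neutral elements, i.e. `e` with `e e = e`; they form the base of the groupoid. -/
def IsNeutral (e : G) : Prop := pmul e e = Part.some e

theorem mem_src {g x : G} : x ∈ pmul (pinv g) g ↔ x = src g := by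
  rw [← Part.get_eq_iff_mem (inv_mul_dom g)]; exact eq_comm

theorem mem_tgt {g x : G} : x ∈ pmul g (pinv g) ↔ x = tgt g := by
  rw [← Part.get_eq_iff_mem (mul_inv_dom g)]; exact eq_comm

theorem mul_mul_mem {f g h k x : G} (hk : k ∈ pmul f g) (hx : x ∈ pmul k h) :
    ∃ l, l ∈ pmul g h ∧ x ∈ pmul f l := by
  have : x ∈ (pmul f g).bind (fun k => pmul k h) := Part.mem_bind_iff.2 ⟨k, hk, hx⟩
  rw [assoc] at this
  exact Part.mem_bind_iff.1 this

theorem mul_mul_mem' {f g h l x : G} (hl : l ∈ pmul g h) (hx : x ∈ pmul f l) :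
    ∃ k, k ∈ pmul f g ∧ x ∈ pmul k h := by
  have : x ∈ (pmul g h).bind (fun k => pmul f k) := Part.mem_bind_iff.2 ⟨l, hl, hx⟩
  rw [← assoc] at this
  exact Part.mem_bind_iff.1 this

theorem mem_mul_inv {f g k : G} (hk : k ∈ pmul f g) : f ∈ pmul k (pinv g) := by
  have h : f ∈ (pmul f g).bind (fun k => pmul k (pinv g)) := by
    rw [mul_inv_cancel f g (Part.dom_iff_mem.2 ⟨k, hk⟩)]; exact Part.mem_some f
  obtain ⟨k', hk', h⟩ := Part.mem_bind_iff.1 h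
  rwa [Part.mem_unique hk hk']

theorem mem_src_mul {f g k : G} (hk : k ∈ pmul f g) : g ∈ pmul (src f) g := by
  have h : g ∈ (pmul (pinv f) f).bind (fun k => pmul k g) := by
    rw [inv_mul_cancel f g (Part.dom_iff_mem.2 ⟨k, hk⟩)]; exact Part.mem_some g
  obtain ⟨k', hk', h⟩ := Part.mem_bind_iff.1 h
  rwa [mem_src.1 hk'] at h

theorem mem_inv_mul {f g k : G} (hk : k ∈ pmul f g) : g ∈ pmul (pinv f) k := by
  obtain ⟨l, hl, h⟩ := mul_mul_mem (mem_src.2 rfl) (mem_src_mul hk)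
  rwa [Part.mem_unique hk hl]

theorem src_mul {f g k : G} (hk : k ∈ pmul f g) : src k = src g := by
  obtain ⟨l, hl, hkl⟩ := mul_mul_mem (mem_mul_inv hk) hk
  rw [mem_src.1 hl] at hkl
  obtain ⟨m, hm, hml⟩ := mul_mul_mem' hkl (mem_inv_mul hkl)
  have h1 := mem_src.2 (rfl : src k = src k)
  exact (mem_src.1 (mem_inv_mul hkl)).symm

theorem tgt_mul {f g k : G} (hk : k ∈ pmul f g) : tgt k = tgt f := by
  obtain ⟨l, hl, hkl⟩ := mul_mul_mem' (mem_inv_mul hk) hk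
  rw [mem_tgt.1 hl] at hkl
  exact (mem_tgt.1 (mem_mul_inv hkl)).symm

theorem src_inv (g : G) : src (pinv g) = tgt g := by
  have h := mem_src_mul (mem_src.2 (rfl : src g = src g))
  exact mem_tgt.1 (mem_mul_inv h)

theorem tgt_inv (g : G) : tgt (pinv g) = src g := by
  have h := mem_inv_mul (mem_tgt.2 (rfl : tgt g = tgt g))
  obtain ⟨k, hk, h'⟩ := mul_mul_mem' (mem_tgt.2 (rfl : tgt g = tgt g)) h
  rw [mem_src.1 hk] at h'
  exact (mem_tgt.1 (mem_mul_inv h')).symm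

end

/-- The restriction of a groupoid to a set `A` of neutral elements: all elements whose source and
target lie in `A`. -/
def Restrict {G : Type*} [PartialGroupoid G] (A : Set G) : Type _ :=
  {g : G // src g ∈ A ∧ tgt g ∈ A}

section

variable {G : Type*} [PartialGroupoid G] {A : Set G}

/-- Composition in the restriction of a groupoid is composition in the groupoid. -/
def Restrict.pmul (f g : Restrict A) : Part (Restrict A) :=
  ⟨(PartialGroupoid.pmul f.1 g.1).Dom, fun h =>
    ⟨(PartialGroupoid.pmul f.1 g.1).get h,
      by rw [src_mul (Part.get_mem h)]; exact g.2.1,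
      by rw [tgt_mul (Part.get_mem h)]; exact f.2.2⟩⟩

theorem Restrict.mem_pmul {f g k : Restrict A} :
    k ∈ Restrict.pmul f g ↔ k.1 ∈ PartialGroupoid.pmul f.1 g.1 :=
  ⟨fun ⟨h, e⟩ => ⟨h, congrArg Subtype.val e⟩, fun ⟨h, e⟩ => ⟨h, Subtype.ext e⟩⟩

theorem Restrict.pmul_mem {f g : Restrict A} {x : G} (hx : x ∈ PartialGroupoid.pmul f.1 g.1) :
    ∃ k : Restrict A, k ∈ Restrict.pmul f g ∧ k.1 = x := by
  obtain ⟨h, e⟩ := hx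
  exact ⟨_, ⟨h, rfl⟩, e⟩

instance : PartialGroupoid (Restrict A) where
  pmul := Restrict.pmul
  pinv g := ⟨pinv g.1, by rw [src_inv]; exact g.2.2, by rw [tgt_inv]; exact g.2.1⟩
  assoc f g h := by
    ext x
    simp only [Part.mem_bind_iff]
    constructor
    · rintro ⟨k, hk, hx⟩
      obtain ⟨l, hl, hx'⟩ := mul_mul_mem (Restrict.mem_pmul.1 hk) (Restrict.mem_pmul.1 hx)
      obtain ⟨l', hl', rfl⟩ := Restrict.pmul_mem hl
      exact ⟨l', hl', Restrict.mem_pmul.2 hx'⟩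
    · rintro ⟨k, hk, hx⟩
      obtain ⟨l, hl, hx'⟩ := mul_mul_mem' (Restrict.mem_pmul.1 hk) (Restrict.mem_pmul.1 hx)
      obtain ⟨l', hl', rfl⟩ := Restrict.pmul_mem hl
      exact ⟨l', hl', Restrict.mem_pmul.2 hx'⟩
  inv_mul_dom g := inv_mul_dom g.1
  mul_inv_dom g := mul_inv_dom g.1
  mul_inv_cancel f g h := by
    rw [Part.eq_some_iff, Part.mem_bind_iff]
    obtain ⟨k, hk⟩ := Part.dom_iff_mem.1 h
    exact ⟨k, hk, Restrict.mem_pmul.2 (mem_mul_inv (Restrict.mem_pmul.1 hk))⟩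
  inv_mul_cancel f g h := by
    rw [Part.eq_some_iff, Part.mem_bind_iff]
    obtain ⟨k, hk⟩ := Part.dom_iff_mem.1 h
    obtain ⟨s, hs, e⟩ := Restrict.pmul_mem (A := A)
      (f := ⟨pinv f.1, by rw [src_inv]; exact f.2.2, by rw [tgt_inv]; exact f.2.1⟩) (g := f)
      (mem_src.2 (rfl : src f.1 = src f.1))
    refine ⟨s, hs, Restrict.mem_pmul.2 ?_⟩
    rw [e]
    exact mem_src_mul (Restrict.mem_pmul.1 hk)

instance [TopologicalSpace G] : TopologicalSpace (Restrict A) :=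
  inferInstanceAs (TopologicalSpace {g : G // src g ∈ A ∧ tgt g ∈ A})

end

/-- A topological groupoid: the topology is Hausdorff, and inversion and composition (where it is
defined) are continuous. -/
class IsTopological (G : Type*) [PartialGroupoid G] [TopologicalSpace G] : Prop where
  t2 : T2Space G
  continuous_inv : Continuous (pinv : G → G)
  continuous_mul : Continuous
    (fun p : {p : G × G // (pmul p.1 p.2).Dom} => (pmul p.1.1 p.1.2).get p.2)

/-- An isomorphism of topological groupoids: a homeomorphism under which a composition is defined
if and only if the composition of the images is, and which sends the one to the other. -/
structure TopIso (G H : Type*) [PartialGroupoid G] [TopologicalSpace G]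
    [PartialGroupoid H] [TopologicalSpace H] extends G ≃ₜ H where
  map_mul' : ∀ f g : G, (pmul f g).map toFun = pmul (toFun f) (toFun g)

/-- The groupoid `B × G × B` over `B`, where `(x, g, y) (y', f, z)` is defined if and only if
`y = y'`, and is then `(x, g f, z)`. -/
def Trivial (B G : Type*) : Type _ := B × G × B

instance (B G : Type*) [Group G] : PartialGroupoid (Trivial B G) where
  pmul p q := ⟨p.2.2 = q.1, fun _ => (p.1, p.2.1 * q.2.1, q.2.2)⟩
  pinv p := (p.2.2, p.2.1⁻¹, p.1)
  assoc := by
    rintro ⟨a, f, b⟩ ⟨c, g, d⟩ ⟨e, h, i⟩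
    refine Part.ext' ?_ ?_
    · simp [Part.bind, Part.assert, and_comm]
    · intro _ _
      exact congrArg (fun k => (a, k, i)) (mul_assoc f g h)
  inv_mul_dom _ := rfl
  mul_inv_dom _ := rfl
  mul_inv_cancel := by
    rintro ⟨a, f, b⟩ ⟨c, g, d⟩ h
    obtain rfl : b = c := h
    exact Part.eq_some_iff.2 (Part.mem_bind_iff.2
      ⟨_, ⟨rfl, rfl⟩, rfl, congrArg (fun k => (a, k, b)) (mul_inv_cancel_right f g)⟩)
  inv_mul_cancel := by
    rintro ⟨a, f, b⟩ ⟨c, g, d⟩ h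
    obtain rfl : b = c := h
    refine Part.eq_some_iff.2 (Part.mem_bind_iff.2
      ⟨_, ⟨rfl, rfl⟩, rfl, congrArg (fun k => (b, k, d)) ?_⟩)
    change f⁻¹ * f * g = g
    simp

instance (B G : Type*) [TopologicalSpace B] [TopologicalSpace G] :
    TopologicalSpace (Trivial B G) :=
  inferInstanceAs (TopologicalSpace (B × G × B))

end PartialGroupoid

/-! ### The automorphism group of a structure -/

section Aut

variable {L : FirstOrder.Language.{u, v}} {M : Type w} [L.Structure M]

/-- The group of automorphisms of `M`, under composition. -/
instance : Group (M ≃[L] M) where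
  mul f g := f.comp g
  one := Language.Equiv.refl L M
  inv f := f.symm
  mul_assoc _ _ _ := rfl
  one_mul _ := rfl
  mul_one _ := rfl
  inv_mul_cancel f := by
    ext x
    exact f.toEquiv.symm_apply_apply x

/-- The topology of pointwise convergence on the automorphism group, `M` being discrete. -/
instance : TopologicalSpace (M ≃[L] M) :=
  TopologicalSpace.induced (fun f => (f : M → M)) (@Pi.topologicalSpace M (fun _ => M) fun _ => ⊥)

end Aut

/-! ### The groupoid of a theory -/

namespace TheoryGroupoid

open PartialGroupoid

variable {L : FirstOrder.Language.{u, v}}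

section

variable {T : L.Theory}

theorem typeOf_eq_iff {α : Type*} {M N : Type*} [L.Structure M] [Nonempty M] [M ⊨ T]
    [L.Structure N] [Nonempty N] [N ⊨ T] {a : α → M} {b : α → N} :
    T.typeOf a = T.typeOf b ↔ ∀ φ : L.Formula α, φ.Realize a ↔ φ.Realize b := by
  rw [SetLike.ext_iff]
  constructor
  · intro h φ
    simpa using h (Formula.equivSentence φ)
  · intro h φ
    simpa using h (Formula.equivSentence.symm φ)

/-- Two enumerations with the same type differ by an isomorphism. -/
theorem exists_equiv {α : Type*} {M N : Type*} [L.Structure M] [Nonempty M] [M ⊨ T]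
    [L.Structure N] [Nonempty N] [N ⊨ T] {a : α → M} {b : α → N}
    (ha : Function.Surjective a) (hb : Function.Surjective b)
    (h : T.typeOf a = T.typeOf b) : ∃ e : M ≃[L] N, ∀ i, e (a i) = b i := by
  rw [typeOf_eq_iff] at h
  have heq : ∀ i j, a i = a j ↔ b i = b j := fun i j => by
    simpa using h (Term.equal (Term.var i) (Term.var j))
  let f : M → N := fun x => b (Function.surjInv ha x)
  have hf : ∀ i, f (a i) = b i := fun i => (heq _ _).1 (Function.surjInv_eq ha (a i))
  have hbij : Function.Bijective f := by
    constructor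
    · intro x y hxy
      obtain ⟨i, rfl⟩ := ha x
      obtain ⟨j, rfl⟩ := ha y
      rw [hf, hf] at hxy
      exact (heq i j).2 hxy
    · intro y
      obtain ⟨i, rfl⟩ := hb y
      exact ⟨a i, hf i⟩
  refine ⟨⟨Equiv.ofBijective f hbij, ?_, ?_⟩, hf⟩
  · intro n F x
    choose c hc using fun k => ha (x k)
    obtain rfl : (fun k => a (c k)) = x := funext hc
    obtain ⟨i, hi⟩ := ha (Structure.funMap F fun k => a (c k))
    have := (h (Term.equal (Term.func F fun k => Term.var (c k)) (Term.var i))).1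
      (by simpa using hi.symm)
    simp only [Formula.realize_equal, Term.realize_func, Term.realize_var] at this
    change f _ = Structure.funMap F fun k => f (a (c k))
    rw [← hi, hf]
    simp only [hf, this]
  · intro n R x
    choose c hc using fun k => ha (x k)
    obtain rfl : (fun k => a (c k)) = x := funext hc
    have := h (R.formula fun k => Term.var (c k))
    simp only [Formula.realize_rel, Term.realize_var] at this
    change (Structure.RelMap R fun k => f (a (c k))) ↔ _
    simp only [hf]
    exact this.symm

theorem typeOf_comp_equiv {α : Type*} {M N : Type*} [L.Structure M] [Nonempty M] [M ⊨ T]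
    [L.Structure N] [Nonempty N] [N ⊨ T] (e : M ≃[L] N) (a : α → M) :
    T.typeOf (fun i => e (a i)) = T.typeOf a := by
  rw [typeOf_eq_iff]
  exact fun φ => StrongHomClass.realize_formula e φ

end

/-- The type `tp(a, b)` of a pair of sequences. -/
def pairType {T : L.Theory} {M : Theory.ModelType.{u, v, 0} T} (a b : ℕ → M) :
    T.CompleteType (ℕ ⊕ ℕ) :=
  T.typeOf (Sum.elim a b)

/-- The groupoid `G₀(T)`: all types `tp(a, b)`, where `a` and `b` are two enumerations, possibly
with repetitions, of a same countable model of `T`. -/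
def G0 (T : L.Theory) : Type _ :=
  {g : T.CompleteType (ℕ ⊕ ℕ) // ∃ (M : Theory.ModelType.{u, v, 0} T) (a b : ℕ → M),
    Function.Surjective a ∧ Function.Surjective b ∧ pairType a b = g}

namespace G0

variable {T : L.Theory}

instance : TopologicalSpace (G0 T) :=
  inferInstanceAs (TopologicalSpace {g : T.CompleteType (ℕ ⊕ ℕ) //
    ∃ (M : Theory.ModelType.{u, v, 0} T) (a b : ℕ → M),
      Function.Surjective a ∧ Function.Surjective b ∧ pairType a b = g})

/-- `g h = k` in `G₀(T)`: for some enumerations `a`, `b`, `c` of a model we have `g = tp(a, b)`,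
`h = tp(b, c)` and `k = tp(a, c)`. -/
def IsMul (g h k : G0 T) : Prop :=
  ∃ (M : Theory.ModelType.{u, v, 0} T) (a b c : ℕ → M),
    Function.Surjective a ∧ Function.Surjective b ∧ Function.Surjective c ∧
    pairType a b = g.1 ∧ pairType b c = h.1 ∧ pairType a c = k.1

/-- `h = g⁻¹` in `G₀(T)`: we have `g = tp(a, b)` and `h = tp(b, a)`. -/
def IsInv (g h : G0 T) : Prop :=
  ∃ (M : Theory.ModelType.{u, v, 0} T) (a b : ℕ → M),
    Function.Surjective a ∧ Function.Surjective b ∧ pairType a b = g.1 ∧ pairType b a = h.1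

theorem exists_equiv_pair {M N : Theory.ModelType.{u, v, 0} T} {a b : ℕ → M} {a' b' : ℕ → N}
    (ha : Function.Surjective a) (ha' : Function.Surjective a')
    (h : pairType a b = pairType a' b') :
    ∃ e : M ≃[L] N, (∀ i, e (a i) = a' i) ∧ ∀ i, e (b i) = b' i := by
  obtain ⟨e, he⟩ := exists_equiv (T := T) (a := Sum.elim a b) (b := Sum.elim a' b')
    (fun x => by obtain ⟨i, rfl⟩ := ha x; exact ⟨.inl i, rfl⟩)
    (fun x => by obtain ⟨i, rfl⟩ := ha' x; exact ⟨.inl i, rfl⟩) h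
  exact ⟨e, fun i => he (.inl i), fun i => he (.inr i)⟩

theorem pairType_equiv {M N : Theory.ModelType.{u, v, 0} T} (e : M ≃[L] N) {a b : ℕ → M}
    {a' b' : ℕ → N} (ha : ∀ i, e (a i) = a' i) (hb : ∀ i, e (b i) = b' i) :
    pairType a b = pairType a' b' := by
  have : Sum.elim a' b' = fun i => e (Sum.elim a b i) := by
    funext i
    cases i with
    | inl i => exact (ha i).symm
    | inr i => exact (hb i).symm
  rw [pairType, pairType, this, typeOf_comp_equiv]

theorem equiv_surj {M N : Theory.ModelType.{u, v, 0} T} (e : M ≃[L] N) {a : ℕ → M}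
    (ha : Function.Surjective a) : Function.Surjective fun i => e (a i) :=
  e.surjective.comp ha

theorem IsMul.unique {g h k k' : G0 T} (H : IsMul g h k) (H' : IsMul g h k') : k = k' := by
  obtain ⟨M, a, b, c, ha, hb, hc, h1, h2, h3⟩ := H
  obtain ⟨N, a', b', c', ha', hb', hc', h1', h2', h3'⟩ := H'
  obtain ⟨e, hea, heb⟩ := exists_equiv_pair ha ha' (h1.trans h1'.symm)
  obtain ⟨e', heb', hec'⟩ := exists_equiv_pair hb hb' (h2.trans h2'.symm)
  have : e = e' := by
    ext x
    obtain ⟨i, rfl⟩ := hb x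
    rw [heb, heb']
  subst this
  exact Subtype.ext (h3.symm.trans ((pairType_equiv e hea hec').trans h3'))

theorem IsInv.unique {g h h' : G0 T} (H : IsInv g h) (H' : IsInv g h') : h = h' := by
  obtain ⟨M, a, b, ha, hb, h1, h2⟩ := H
  obtain ⟨N, a', b', ha', hb', h1', h2'⟩ := H'
  obtain ⟨e, hea, heb⟩ := exists_equiv_pair ha ha' (h1.trans h1'.symm)
  exact Subtype.ext (h2.symm.trans ((pairType_equiv e heb hea).trans h2'))

theorem exists_isInv (g : G0 T) : ∃ h, IsInv g h := by
  obtain ⟨g, M, a, b, ha, hb, h⟩ := g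
  exact ⟨⟨pairType b a, M, b, a, hb, ha, rfl⟩, M, a, b, ha, hb, h, rfl⟩

/-- Composition in `G₀(T)`. -/
noncomputable def mul (g h : G0 T) : Part (G0 T) :=
  ⟨∃ k, IsMul g h k, fun H => H.choose⟩

/-- Inversion in `G₀(T)`. -/
noncomputable def inv (g : G0 T) : G0 T := (exists_isInv g).choose

theorem mem_mul {g h k : G0 T} : k ∈ mul g h ↔ IsMul g h k :=
  ⟨fun ⟨H, e⟩ => e ▸ H.choose_spec, fun H => ⟨⟨k, H⟩, IsMul.unique (Exists.choose_spec _) H⟩⟩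

theorem inv_eq_iff {g h : G0 T} : inv g = h ↔ IsInv g h :=
  ⟨fun e => e ▸ (exists_isInv g).choose_spec, fun H => (exists_isInv g).choose_spec.unique H⟩

noncomputable instance : PartialGroupoid (G0 T) where
  pmul := mul
  pinv := inv
  assoc f g h := by
    ext x
    simp only [Part.mem_bind_iff, mem_mul]
    constructor
    · rintro ⟨k, ⟨M, a, b, c, ha, hb, hc, h1, h2, h3⟩, ⟨N, a', c', d', ha', hc', hd', h4, h5, h6⟩⟩
      obtain ⟨e, hea, hec⟩ := exists_equiv_pair ha ha' (h3.trans h4.symm)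
      have hb' := equiv_surj e hb
      exact ⟨⟨_, N, _, d', hb', hd', rfl⟩,
        ⟨N, _, c', d', hb', hc', hd', (pairType_equiv e (fun _ => rfl) hec).symm.trans h2, h5, rfl⟩,
        ⟨N, a', _, d', ha', hb', hd', (pairType_equiv e hea fun _ => rfl).symm.trans h1, rfl, h6⟩⟩
    · rintro ⟨k, ⟨M, b, c, d, hb, hc, hd, h1, h2, h3⟩, ⟨N, a', b', d', ha', hb', hd', h4, h5, h6⟩⟩
      obtain ⟨e, heb, hed⟩ := exists_equiv_pair hb hb' (h3.trans h5.symm)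
      have hc' := equiv_surj e hc
      exact ⟨⟨_, N, a', _, ha', hc', rfl⟩,
        ⟨N, a', b', _, ha', hb', hc', h4, (pairType_equiv e heb fun _ => rfl).symm.trans h1, rfl⟩,
        ⟨N, a', _, d', ha', hc', hd', rfl, (pairType_equiv e (fun _ => rfl) hed).symm.trans h2,
          h6⟩⟩
  inv_mul_dom g := by
    obtain ⟨M, a, b, ha, hb, h1, h2⟩ := inv_eq_iff.1 (rfl : inv g = inv g)
    exact ⟨⟨_, M, b, b, hb, hb, rfl⟩, M, b, a, b, hb, ha, hb, h2, h1, rfl⟩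
  mul_inv_dom g := by
    obtain ⟨M, a, b, ha, hb, h1, h2⟩ := inv_eq_iff.1 (rfl : inv g = inv g)
    exact ⟨⟨_, M, a, a, ha, ha, rfl⟩, M, a, b, a, ha, hb, ha, h1, h2, rfl⟩
  mul_inv_cancel f g h := by
    obtain ⟨k, hk⟩ := h
    rw [Part.eq_some_iff, Part.mem_bind_iff]
    refine ⟨k, mem_mul.2 hk, mem_mul.2 ?_⟩
    obtain ⟨M, a, b, c, ha, hb, hc, h1, h2, h3⟩ := hk
    have : inv g = ⟨pairType c b, M, c, b, hc, hb, rfl⟩ :=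
      inv_eq_iff.2 ⟨M, b, c, hb, hc, h2, rfl⟩
    rw [this]
    exact ⟨M, a, c, b, ha, hc, hb, h3, rfl, h1⟩
  inv_mul_cancel f g h := by
    obtain ⟨k, M, a, b, c, ha, hb, hc, h1, h2, h3⟩ := h
    rw [Part.eq_some_iff, Part.mem_bind_iff]
    have : inv f = ⟨pairType b a, M, b, a, hb, ha, rfl⟩ :=
      inv_eq_iff.2 ⟨M, a, b, ha, hb, h1, rfl⟩
    rw [this]
    exact ⟨⟨pairType b b, M, b, b, hb, hb, rfl⟩, mem_mul.2 ⟨M, b, a, b, hb, ha, hb, rfl, h1, rfl⟩,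
      mem_mul.2 ⟨M, b, b, c, hb, hb, hc, rfl, h2, h2⟩⟩

end G0

/-- A sequence of formulas `φₙ(x₀, …, xₙ₋₁, y)` is rich if every formula `φ(x₀, …, xₖ₋₁, y)` is,
up to adding dummy variables, `φₙ` for some `n ≥ k`. -/
def IsRich (Φ : ∀ n : ℕ, L.Formula (Fin n ⊕ Unit)) : Prop :=
  ∀ (k : ℕ) (φ : L.Formula (Fin k ⊕ Unit)),
    ∃ (n : ℕ) (h : k ≤ n), Φ n = φ.relabel (Sum.map (Fin.castLE h) id)

/-- The formula `∀ y, φₖ(x₀, …, xₖ₋₁, y) → φₖ(x₀, …, xₖ₋₁, xₖ)`. -/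
noncomputable def witnessFormula (Φ : ∀ n : ℕ, L.Formula (Fin n ⊕ Unit)) (k : ℕ) : L.Formula ℕ :=
  Formula.iAlls Unit
    ((Φ k).relabel (Sum.map (fun i : Fin k => (i : ℕ)) id) ⟹
      (Φ k).relabel (Sum.elim (fun i : Fin k => Sum.inl (i : ℕ)) fun _ => Sum.inl k))

theorem realize_witnessFormula {M : Type*} [L.Structure M]
    (Φ : ∀ n : ℕ, L.Formula (Fin n ⊕ Unit)) (k : ℕ) (a : ℕ → M) :
    (witnessFormula Φ k).Realize a ↔
      ∀ y : M, (Φ k).Realize (Sum.elim (fun i : Fin k => a i) fun _ => y) →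
        (Φ k).Realize (Sum.elim (fun i : Fin k => a i) fun _ => a k) := by
  have h1 : ∀ y : Unit → M, (fun i => Sum.elim a y i) ∘ Sum.map (fun i : Fin k => (i : ℕ)) id =
      Sum.elim (fun i : Fin k => a i) fun _ => y () := by
    intro y; funext i; cases i <;> rfl
  have h2 : ∀ y : Unit → M, (fun i => Sum.elim a y i) ∘
      Sum.elim (fun i : Fin k => Sum.inl (i : ℕ)) (fun _ : Unit => Sum.inl k) =
      Sum.elim (fun i : Fin k => a i) fun _ : Unit => a k := by
    intro y; funext i; cases i <;> rfl
  rw [witnessFormula, Formula.realize_iAlls]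
  simp only [Formula.realize_imp, Formula.realize_relabel, h1, h2]
  exact ⟨fun h y => h fun _ => y, fun h y => h (y ())⟩

/-- The base `B_Φ(T)`, as a set of neutral elements of `G₀(T)`: the types `tp(a, a)` where `a`
satisfies `D_Φ`, the conjunction of all `witnessFormula Φ k`. -/
def BPhi (T : L.Theory) (Φ : ∀ n : ℕ, L.Formula (Fin n ⊕ Unit)) : Set (G0 T) :=
  {e | IsNeutral e ∧ ∀ k, Formula.equivSentence ((witnessFormula Φ k).relabel Sum.inl) ∈ e.1}

/-- The groupoid `G_Φ(T)`: all `g` in `G₀(T)` whose source and target lie in `B_Φ(T)`. -/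
abbrev GPhi (T : L.Theory) (Φ : ∀ n : ℕ, L.Formula (Fin n ⊕ Unit)) : Type _ :=
  Restrict (BPhi T Φ)

/-- Rich sequences exist in a countable language. -/
theorem exists_isRich [Countable L.Symbols] :
    ∃ Φ : ∀ n : ℕ, L.Formula (Fin n ⊕ Unit), IsRich Φ := by
  have : Nonempty (Σ k : ℕ, L.Formula (Fin k ⊕ Unit)) := ⟨⟨0, ⊥⟩⟩
  obtain ⟨e, he⟩ := exists_surjective_nat (Σ k : ℕ, L.Formula (Fin k ⊕ Unit))
  classical
  refine ⟨fun n => if h : (e n.unpair.1).1 ≤ n then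
    (e n.unpair.1).2.relabel (Sum.map (Fin.castLE h) id) else ⊥, fun k φ => ?_⟩
  obtain ⟨i, hi⟩ := he ⟨k, φ⟩
  have hk : (e (Nat.pair i k).unpair.1).1 ≤ Nat.pair i k := by
    rw [Nat.unpair_pair, hi]; exact Nat.right_le_pair i k
  have hk' : k ≤ Nat.pair i k := Nat.right_le_pair i k
  refine ⟨Nat.pair i k, hk', ?_⟩
  refine (dif_pos hk).trans ?_
  have : e (Nat.pair i k).unpair.1 = ⟨k, φ⟩ := by rw [Nat.unpair_pair, hi]
  revert hk
  rw [this]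
  intro _
  rfl

end TheoryGroupoid

/-!
Call a sequence Henkin if it satisfies `D_Φ`.

By the Tarski–Vaught test the terms of a Henkin sequence form an elementary substructure.  It is
a countable model of `T`, hence isomorphic to `M`: so the types of Henkin sequences, which form a
compact subspace `henkinTypes T Φ` of the type space, are all realized by enumerations of `M`
(`exists_surjective_of_mem_henkinTypes`).

*Atomicity.*  Every type of a tuple `c` of `M` is isolated (`exists_isolating_formula`).  Indeed `c`
occurs in every enumeration of `M`, so `henkinTypes T Φ` is a countable union of closed sets, on
each of which the type of `c` occurs at given places.
One of them has an interior point by Baire's theorem, and a neighbourhood of this point yields an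
isolating formula.

*A continuous choice of enumerations.*  There is a map `s` that sends a Henkin type `p` to an
enumeration of `M` of type `p`, each term of which is locally constant in `p`
(`exists_continuous_enumeration`).  It is built by back and forth.  Suppose that `c₀, …, cₙ₋₁` have
been found, and let `m` be the next element of `M` to be enumerated.  The formula that isolates the
type of `c₀, …, cₙ₋₁, m` is some `Φ K` with `n ≤ K`, up to dummy variables, so that `m` may be
placed at `K`; here `K` depends on the tuple and not on `p`.
The terms `cₙ, …, c_K` are then chosen in terms of the restriction of `p` to the first `K + 1`
variables, which is locally constant since it is isolated.

*The base.*  The space `henkinTypes T Φ` has no isolated points, as `Φ` contains `⊤` at arbitrarily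
large places `K`, where the term `x_K` of a Henkin sequence is free and `M` has two elements to
choose from.  By Brouwer's theorem (`nonempty_homeomorph_cantor`) it is a Cantor space.

*The isomorphism.*  It is the inverse of `(x, σ, y) ↦ tp(s x, σ (s y))` (`ofTrivial`), where `s` is
now indexed by the Cantor space.  This respects composition because
`tp(s y, τ (s z)) = tp(σ (s y), σ (τ (s z)))`.  It is bijective because two enumerations of the same
type differ by an automorphism, which is unique.  It is continuous in both directions because the
terms of `s` are locally constant.  That the groupoid of the theory is topological follows from the
isomorphism.
-/

open Set Filter Topology

/-! ### The Cantor space -/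

section Cantor

variable {X : Type*}

/-- The piece of `X` reached along the branch `f` after `n` steps, when `V n U` is the set by which
a piece `U` is split at step `n`. -/
def splitPiece (V : ℕ → Set X → Set X) (f : ℕ → Bool) : ℕ → Set X
  | 0 => univ
  | n + 1 => if f n = true then splitPiece V f n ∩ V n (splitPiece V f n)
      else splitPiece V f n \ V n (splitPiece V f n)

open Classical in
/-- The piece containing `x` after `n` steps. -/
noncomputable def pieceOf (V : ℕ → Set X → Set X) (x : X) : ℕ → Set X
  | 0 => univ
  | n + 1 => if x ∈ V n (pieceOf V x n) then pieceOf V x n ∩ V n (pieceOf V x n)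
      else pieceOf V x n \ V n (pieceOf V x n)

open Classical in
/-- The branch followed by `x`. -/
noncomputable def branchOf (V : ℕ → Set X → Set X) (x : X) (n : ℕ) : Bool :=
  decide (x ∈ V n (pieceOf V x n))

theorem mem_pieceOf (V : ℕ → Set X → Set X) (x : X) (n : ℕ) : x ∈ pieceOf V x n := by
  induction n with
  | zero => trivial
  | succ n ih =>
    rw [pieceOf]
    split_ifs with h
    exacts [⟨ih, h⟩, ⟨ih, h⟩]

theorem splitPiece_branchOf (V : ℕ → Set X → Set X) (x : X) (n : ℕ) :
    splitPiece V (branchOf V x) n = pieceOf V x n := by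
  induction n with
  | zero => rfl
  | succ n ih =>
    rw [splitPiece, pieceOf, ih]
    by_cases h : x ∈ V n (pieceOf V x n) <;> simp [branchOf, h]

theorem splitPiece_succ_subset (V : ℕ → Set X → Set X) (f : ℕ → Bool) (n : ℕ) :
    splitPiece V f (n + 1) ⊆ splitPiece V f n := by
  rw [splitPiece]
  split_ifs
  exacts [inter_subset_left, sdiff_subset]

theorem pieceOf_eq_of_mem (V : ℕ → Set X → Set X) {f : ℕ → Bool} {x : X} {n : ℕ}
    (h : x ∈ splitPiece V f n) :
    pieceOf V x n = splitPiece V f n ∧ ∀ k < n, branchOf V x k = f k := by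
  induction n with
  | zero => exact ⟨rfl, fun k hk => absurd hk (Nat.not_lt_zero k)⟩
  | succ n ih =>
    obtain ⟨h1, h2⟩ := ih (splitPiece_succ_subset V f n h)
    have h3 : branchOf V x n = f n := by
      rw [splitPiece] at h
      rw [branchOf, h1]
      cases hf : f n <;> simp [hf] at h <;> simp [h.2]
    refine ⟨?_, fun k hk => ?_⟩
    · rw [pieceOf, splitPiece, ← h3, branchOf, h1]
      by_cases h' : x ∈ V n (splitPiece V f n) <;> simp [h']
    · obtain hk | rfl := Nat.lt_succ_iff_lt_or_eq.1 hk
      exacts [h2 k hk, h3]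

variable [TopologicalSpace X]

/-- Brouwer's characterization of the Cantor space.  Each piece is split into two nonempty clopen
pieces, at step `n` by `C n` whenever possible; hence the pieces along a branch shrink to a
point. -/
theorem nonempty_homeomorph_cantor [CompactSpace X] [Nonempty X] (C : ℕ → Set X)
    (hC : ∀ n, IsClopen (C n)) (hsep : ∀ x y, (∀ n, x ∈ C n ↔ y ∈ C n) → x = y)
    (hperf : ∀ U : Set X, IsOpen U → U.Nonempty → U.Nontrivial) :
    Nonempty (X ≃ₜ (ℕ → Bool)) := by
  have hsplit : ∀ (n : ℕ) (U : Set X), ∃ V : Set X, IsClopen V ∧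
      (IsOpen U → U.Nonempty → (U ∩ V).Nonempty ∧ (U \ V).Nonempty ∧
        ∀ x ∈ U, ∀ y ∈ U, (x ∈ V ↔ y ∈ V) → (x ∈ C n ↔ y ∈ C n)) := by
    intro n U
    by_cases h : (U ∩ C n).Nonempty ∧ (U \ C n).Nonempty
    · exact ⟨C n, hC n, fun _ _ => ⟨h.1, h.2, fun x _ y _ h => h⟩⟩
    by_cases hU : IsOpen U ∧ U.Nonempty
    · obtain ⟨x, hx, y, hy, hxy⟩ := hperf U hU.1 hU.2
      have : ∃ m, ¬ (x ∈ C m ↔ y ∈ C m) := by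
        by_contra hcon
        push Not at hcon
        exact hxy (hsep x y hcon)
      obtain ⟨m, hm⟩ := this
      have hdec : ∀ x ∈ U, ∀ y ∈ U, x ∈ C n → y ∈ C n := by
        intro x hx y hy hxn
        by_contra hyn
        exact h ⟨⟨x, hx, hxn⟩, ⟨y, hy, hyn⟩⟩
      refine ⟨C m, hC m, fun _ _ => ⟨?_, ?_, fun x hx y hy _ =>
        ⟨hdec x hx y hy, hdec y hy x hx⟩⟩⟩
      · by_cases hxm : x ∈ C m
        · exact ⟨x, hx, hxm⟩
        · exact ⟨y, hy, by tauto⟩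
      · by_cases hxm : x ∈ C m
        · exact ⟨y, hy, by tauto⟩
        · exact ⟨x, hx, hxm⟩
    · exact ⟨C n, hC n, fun h1 h2 => absurd ⟨h1, h2⟩ hU⟩
  choose V hV hsp using hsplit
  have hclopen : ∀ f n, IsClopen (splitPiece V f n) := by
    intro f n
    induction n with
    | zero => exact isClopen_univ
    | succ n ih =>
      rw [splitPiece]
      split_ifs
      exacts [ih.inter (hV _ _), ih.diff (hV _ _)]
  have hne : ∀ f n, (splitPiece V f n).Nonempty := by
    intro f n
    induction n with
    | zero => exact univ_nonempty
    | succ n ih =>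
      rw [splitPiece]
      split_ifs
      exacts [(hsp n _ (hclopen f n).isOpen ih).1, (hsp n _ (hclopen f n).isOpen ih).2.1]
  have : T2Space X := by
    refine ⟨fun x y hxy => ?_⟩
    by_contra hcon
    refine hxy (hsep x y fun n => ?_)
    by_contra hn
    refine hcon ?_
    by_cases hx : x ∈ C n
    · exact ⟨C n, (C n)ᶜ, (hC n).isOpen, (hC n).compl.isOpen, hx, by simpa [hx] using hn,
        disjoint_compl_right⟩
    · exact ⟨(C n)ᶜ, C n, (hC n).compl.isOpen, (hC n).isOpen, hx, by simpa [hx] using hn,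
        disjoint_compl_left⟩
  have hcont : Continuous (branchOf V) := by
    refine continuous_pi fun n => continuous_iff_continuousAt.2 fun x => ?_
    refine tendsto_nhds_of_eventually_eq ?_
    filter_upwards [(hclopen (branchOf V x) (n + 1)).isOpen.mem_nhds
      (by rw [splitPiece_branchOf]; exact mem_pieceOf V x _)] with y hy
    exact (pieceOf_eq_of_mem V hy).2 n n.lt_succ_self
  have hinj : Function.Injective (branchOf V) := by
    intro x y hxy
    refine hsep x y fun n => ?_
    have hx : x ∈ splitPiece V (branchOf V x) n := by
      rw [splitPiece_branchOf]; exact mem_pieceOf V x _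
    have hy : y ∈ splitPiece V (branchOf V x) n := by
      rw [hxy, splitPiece_branchOf]; exact mem_pieceOf V y _
    refine (hsp n _ (hclopen _ n).isOpen (hne _ n)).2.2 x hx y hy ?_
    have h := congrFun hxy n
    rw [branchOf, branchOf, (pieceOf_eq_of_mem V hx).1, (pieceOf_eq_of_mem V hy).1] at h
    simpa using h
  have hsurj : Function.Surjective (branchOf V) := by
    intro f
    obtain ⟨x, hx⟩ := IsCompact.nonempty_iInter_of_sequence_nonempty_isCompact_isClosed
      (splitPiece V f) (splitPiece_succ_subset V f) (hne f) (hclopen f 0).isClosed.isCompact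
      fun n => (hclopen f n).isClosed
    rw [mem_iInter] at hx
    exact ⟨x, funext fun n => (pieceOf_eq_of_mem V (hx (n + 1))).2 n n.lt_succ_self⟩
  exact ⟨Continuous.homeoOfEquivCompactToT2 (f := Equiv.ofBijective _ ⟨hinj, hsurj⟩) hcont⟩

end Cantor

/-! ### Topological groupoids -/

namespace PartialGroupoid

section Transfer

variable {G H : Type*} [PartialGroupoid G] [PartialGroupoid H]

/-- A map that respects composition respects inversion. -/
theorem map_pinv {F : G → H} (hF : ∀ f g : G, (pmul f g).map F = pmul (F f) (F g)) (g : G) :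
    F (pinv g) = pinv (F g) := by
  have hmem : ∀ {f g k : G}, k ∈ pmul f g → F k ∈ pmul (F f) (F g) := by
    intro f g k hk
    rw [← hF]
    exact Part.mem_map F hk
  have h0 := mem_tgt.2 (rfl : tgt g = tgt g)
  have h1 : g ∈ pmul (tgt g) g := by
    rw [← src_inv]
    exact mem_src_mul (mem_src.2 (rfl : src g = src g))
  have h2 : F (tgt g) = tgt (F g) := mem_tgt.1 (mem_mul_inv (hmem h1))
  have h3 := mem_inv_mul (hmem h0)
  have h4 := mem_inv_mul (mem_tgt.2 (rfl : tgt (F g) = tgt (F g)))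
  rw [h2] at h3
  exact Part.mem_unique h3 h4

variable [TopologicalSpace G] [TopologicalSpace H]

theorem TopIso.isTopological (e : TopIso G H) [hH : IsTopological H] : IsTopological G where
  t2 := by
    have := hH.t2
    exact e.toHomeomorph.symm.t2Space
  continuous_inv := by
    have h : (pinv : G → G) = fun g => e.toHomeomorph.symm (pinv (e.toHomeomorph g)) := by
      funext g
      rw [Homeomorph.eq_symm_apply]
      exact map_pinv e.map_mul' g
    rw [h]
    exact e.symm.continuous.comp (hH.continuous_inv.comp e.continuous)
  continuous_mul := by
    have hdom : ∀ p : {p : G × G // (pmul p.1 p.2).Dom},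
        (pmul (e.toHomeomorph p.1.1) (e.toHomeomorph p.1.2)).Dom := by
      intro p
      have := e.map_mul' p.1.1 p.1.2
      exact (congrArg Part.Dom this).mp p.2
    have h : (fun p : {p : G × G // (pmul p.1 p.2).Dom} => (pmul p.1.1 p.1.2).get p.2) =
        fun p => e.toHomeomorph.symm ((pmul (e.toHomeomorph p.1.1) (e.toHomeomorph p.1.2)).get
          (hdom p)) := by
      funext p
      rw [Homeomorph.eq_symm_apply]
      refine (Part.get_eq_of_mem ?_ (hdom p)).symm
      have := e.map_mul' p.1.1 p.1.2
      change _ ∈ pmul (e.toFun p.1.1) (e.toFun p.1.2)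
      rw [← this]
      exact Part.mem_map _ (Part.get_mem p.2)
    rw [h]
    refine e.symm.continuous.comp (hH.continuous_mul.comp
      (f := fun p : {p : G × G // (pmul p.1 p.2).Dom} =>
        (⟨(e.toHomeomorph p.1.1, e.toHomeomorph p.1.2), hdom p⟩ :
          {p : H × H // (pmul p.1 p.2).Dom})) ?_)
    exact Continuous.subtype_mk
      ((e.continuous.comp (continuous_fst.comp continuous_subtype_val)).prodMk
        (e.continuous.comp (continuous_snd.comp continuous_subtype_val))) _

end Transfer

theorem Trivial.isTopological {B G : Type*} [TopologicalSpace B] [T2Space B] [Group G]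
    [TopologicalSpace G] [IsTopologicalGroup G] [T2Space G] : IsTopological (Trivial B G) where
  t2 := inferInstanceAs (T2Space (B × G × B))
  continuous_inv := by
    change Continuous fun p : B × G × B => (p.2.2, p.2.1⁻¹, p.1)
    fun_prop
  continuous_mul := by
    change Continuous fun p : {p : (B × G × B) × (B × G × B) // p.1.2.2 = p.2.1} =>
      (p.1.1.1, p.1.1.2.1 * p.1.2.2.1, p.1.2.2.2)
    fun_prop

end PartialGroupoid

/-! ### The topology of the automorphism group -/

section Aut

variable {L : FirstOrder.Language.{u, v}} {M : Type w} [L.Structure M]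

theorem Aut.eventually_apply_eq (σ : M ≃[L] M) (m : M) : ∀ᶠ τ in 𝓝 σ, τ m = σ m := by
  let _ : TopologicalSpace M := ⊥
  have : DiscreteTopology M := ⟨rfl⟩
  have h : Continuous fun τ : M ≃[L] M => τ m :=
    (continuous_apply m).comp continuous_induced_dom
  simpa [nhds_discrete] using h.tendsto σ

theorem Aut.continuous_of_eventually {X : Type*} [TopologicalSpace X] {f : X → M ≃[L] M}
    (h : ∀ m x, ∀ᶠ y in 𝓝 x, f y m = f x m) : Continuous f := by
  let _ : TopologicalSpace M := ⊥
  refine continuous_induced_rng.2 (continuous_pi fun m => continuous_iff_continuousAt.2 fun x =>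
    tendsto_nhds_of_eventually_eq (h m x))

@[simp]
theorem Aut.mul_apply (σ τ : M ≃[L] M) (m : M) : (σ * τ) m = σ (τ m) := rfl

@[simp]
theorem Aut.inv_apply_self (σ : M ≃[L] M) (m : M) : σ⁻¹ (σ m) = m :=
  σ.toEquiv.symm_apply_apply m

@[simp]
theorem Aut.apply_inv_self (σ : M ≃[L] M) (m : M) : σ (σ⁻¹ m) = m :=
  σ.toEquiv.apply_symm_apply m

instance : IsTopologicalGroup (M ≃[L] M) where
  continuous_mul := Aut.continuous_of_eventually fun m p => by
    rw [nhds_prod_eq]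
    filter_upwards [(Aut.eventually_apply_eq p.1 (p.2 m)).prod_mk
      (Aut.eventually_apply_eq p.2 m)] with q hq
    rw [Aut.mul_apply, Aut.mul_apply, hq.2, hq.1]
  continuous_inv := Aut.continuous_of_eventually fun m σ => by
    filter_upwards [Aut.eventually_apply_eq σ (σ⁻¹ m)] with τ hτ
    rw [Aut.apply_inv_self] at hτ
    conv_lhs => rw [← hτ]
    rw [Aut.inv_apply_self]

instance : T2Space (M ≃[L] M) := by
  let _ : TopologicalSpace M := ⊥
  have : DiscreteTopology M := ⟨rfl⟩
  exact T2Space.of_injective_continuous (f := fun σ : M ≃[L] M => (σ : M → M))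
    DFunLike.coe_injective continuous_induced_dom

end Aut

/-! ### Henkin sequences -/

namespace TheoryGroupoid

variable {L : FirstOrder.Language.{u, v}}

section Henkin

variable {M : Type*} [L.Structure M]

/-- A formula depends on finitely many variables only. -/
theorem exists_finset_realize_congr (M : Type*) [L.Structure M] {α : Type*} (φ : L.Formula α) :
    ∃ F : Finset α, ∀ a a' : α → M, (∀ i ∈ F, a i = a' i) → (φ.Realize a ↔ φ.Realize a') := by
  classical
  refine ⟨φ.freeVarFinset, fun a a' h => ?_⟩
  rw [Formula.Realize, Formula.Realize,
    ← BoundedFormula.realize_restrictFreeVar' (s := φ.freeVarFinset) subset_rfl (v := a),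
    ← BoundedFormula.realize_restrictFreeVar' (s := φ.freeVarFinset) subset_rfl (v := a')]
  have : (a ∘ ((↑) : φ.freeVarFinset → α)) = a' ∘ (↑) := funext fun i => h _ i.2
  exact iff_of_eq (congrArg (fun x => BoundedFormula.Realize _ x default) this)

theorem exists_realize_congr (M : Type*) [L.Structure M] (φ : L.Formula ℕ) :
    ∃ m, ∀ a a' : ℕ → M, (∀ i < m, a i = a' i) → (φ.Realize a ↔ φ.Realize a') := by
  obtain ⟨F, hF⟩ := exists_finset_realize_congr M φ
  exact ⟨F.sup id + 1, fun a a' h =>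
    hF a a' fun i hi => h i (Nat.lt_succ_of_le (Finset.le_sup (f := id) hi))⟩

variable (Φ : ∀ n : ℕ, L.Formula (Fin n ⊕ Unit))

/-- The sequence `a` satisfies `D_Φ`. -/
def IsHenkin (a : ℕ → M) : Prop := ∀ k, (witnessFormula Φ k).Realize a

theorem realize_witnessFormula_congr {k : ℕ} {a a' : ℕ → M} (h : ∀ i ≤ k, a i = a' i) :
    (witnessFormula Φ k).Realize a ↔ (witnessFormula Φ k).Realize a' := by
  rw [realize_witnessFormula, realize_witnessFormula, h k le_rfl]
  have : (fun i : Fin k => a i) = fun i : Fin k => a' i := funext fun i => h i i.2.le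
  rw [this]

open Classical in
/-- The sequence that agrees with `a` below `m` and, for `n ≥ m`, takes as its `n`-th term a witness
for `Φ n`, if there is one, and an arbitrary element otherwise. -/
noncomputable def henkinSeq [Nonempty M] (a : ℕ → M) (m : ℕ) : ℕ → M
  | n => if n < m then a n else Classical.epsilon fun y : M =>
      (Φ n).Realize (Sum.elim (fun i : Fin n => henkinSeq a m i) fun _ => y)
decreasing_by exact i.2

theorem henkinSeq_of_lt [Nonempty M] (a : ℕ → M) {m n : ℕ} (h : n < m) :
    henkinSeq Φ a m n = a n := by
  rw [henkinSeq, if_pos h]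

theorem isHenkin_henkinSeq [Nonempty M] (a : ℕ → M) (m : ℕ)
    (h : ∀ k < m, (witnessFormula Φ k).Realize a) : IsHenkin Φ (henkinSeq Φ a m) := by
  intro k
  by_cases hk : k < m
  · rw [realize_witnessFormula_congr Φ fun i hi => henkinSeq_of_lt Φ a (hi.trans_lt hk)]
    exact h k hk
  · rw [realize_witnessFormula]
    intro y hy
    have := Classical.epsilon_spec (p := fun y : M =>
      (Φ k).Realize (Sum.elim (fun i : Fin k => henkinSeq Φ a m i) fun _ => y)) ⟨y, hy⟩
    rw [henkinSeq.eq_def Φ a m k, if_neg hk]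
    exact this

variable {Φ}

/-- Along a Henkin sequence, every satisfiable formula in one free variable with parameters among
the first `k` terms is satisfied by a later term, at a position that depends on the formula only. -/
theorem IsRich.exists_witness (hΦ : IsRich Φ) {k : ℕ} (φ : L.Formula (Fin k ⊕ Unit)) :
    ∃ n ≥ k, ∀ {M : Type w} [L.Structure M] {a : ℕ → M}, IsHenkin Φ a → ∀ y : M,
      φ.Realize (Sum.elim (fun i : Fin k => a i) fun _ => y) →
      φ.Realize (Sum.elim (fun i : Fin k => a i) fun _ => a n) := by
  obtain ⟨n, hn, h⟩ := hΦ k φ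
  refine ⟨n, hn, fun {M _ a} ha y hy => ?_⟩
  have h1 := (realize_witnessFormula Φ n a).1 (ha n) y
  have h2 : ∀ z : M, (Sum.elim (fun i : Fin n => a i) fun _ : Unit => z) ∘
      Sum.map (Fin.castLE hn) id = Sum.elim (fun i : Fin k => a i) fun _ => z := by
    intro z; funext i; cases i <;> rfl
  rw [h, Formula.realize_relabel, Formula.realize_relabel, h2, h2] at h1
  exact h1 hy

/-- The range of a Henkin sequence is an elementary substructure, by the Tarski–Vaught test. -/
theorem IsRich.exists_elementarySubstructure (hΦ : IsRich Φ) {N : Type w} [L.Structure N]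
    {a : ℕ → N} (ha : IsHenkin Φ a) :
    ∃ S : L.ElementarySubstructure N, (S : Set N) = range a := by
  have key : ∀ {ι : Type} [Finite ι] (φ : L.Formula (ι ⊕ Unit)) (c : ι → ℕ) (y : N),
      φ.Realize (Sum.elim (a ∘ c) fun _ => y) → ∃ n, φ.Realize (Sum.elim (a ∘ c) fun _ => a n) := by
    intro ι _ φ c y hy
    obtain ⟨k, hk⟩ := (finite_range c).bddAbove
    have hk' : ∀ i, c i < k + 1 := fun i => Nat.lt_succ_of_le (hk ⟨i, rfl⟩)
    obtain ⟨n, -, hn⟩ := hΦ.exists_witness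
      (φ.relabel (Sum.map (fun i => (⟨c i, hk' i⟩ : Fin (k + 1))) id))
    have h2 : ∀ z : N, (Sum.elim (fun i : Fin (k + 1) => a i) fun _ : Unit => z) ∘
        Sum.map (fun i => (⟨c i, hk' i⟩ : Fin (k + 1))) id = Sum.elim (a ∘ c) fun _ => z := by
      intro z; funext i; cases i <;> rfl
    have h3 := hn ha y
    rw [Formula.realize_relabel, Formula.realize_relabel, h2, h2] at h3
    exact ⟨n, h3 hy⟩
  let S : L.Substructure N :=
    { carrier := range a
      fun_mem := by
        intro n f x hx
        choose c hc using hx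
        obtain rfl : a ∘ c = x := funext hc
        obtain ⟨j, hj⟩ := key (Term.equal (Term.func f fun i => Term.var (.inl i))
          (Term.var (.inr ()))) c (Structure.funMap f (a ∘ c)) (by simp; rfl)
        refine ⟨j, ?_⟩
        simp only [Formula.realize_equal, Term.realize_func, Term.realize_var, Sum.elim_inl,
          Sum.elim_inr] at hj
        exact hj.symm }
  have hS : ∀ x : S, ∃ n, a n = x := fun x => x.2
  refine ⟨S.toElementarySubstructure fun n φ x y hy => ?_, rfl⟩
  choose c hc using fun i => hS (x i)
  have hx : ((↑) ∘ x : Fin n → N) = a ∘ c := (funext hc).symm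
  have h2 : ∀ z : N, φ.Realize default (Fin.snoc (a ∘ c) z : _ → N) ↔
      (φ.toFormula.relabel (Sum.elim Empty.elim
        (Fin.snoc (α := fun _ => Fin n ⊕ Unit) Sum.inl (Sum.inr ())))).Realize
        (Sum.elim (a ∘ c) fun _ => z) := by
    intro z
    rw [Formula.realize_relabel, BoundedFormula.realize_toFormula]
    have e1 : (((Sum.elim (a ∘ c) fun _ => z) ∘ Sum.elim Empty.elim
      (Fin.snoc (α := fun _ => Fin n ⊕ Unit) Sum.inl (Sum.inr ()))) ∘ Sum.inl : Empty → N) =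
      default := Subsingleton.elim _ _
    have e2 : (((Sum.elim (a ∘ c) fun _ => z) ∘ Sum.elim Empty.elim
      (Fin.snoc (α := fun _ => Fin n ⊕ Unit) Sum.inl (Sum.inr ()))) ∘ Sum.inr : _ → N) =
      Fin.snoc (α := fun _ => N) (a ∘ c) z := by
      funext i
      refine Fin.lastCases ?_ (fun i => ?_) i <;> simp
    rw [e1, e2]
  rw [hx, h2] at hy
  obtain ⟨m, hm⟩ := key _ c y hy
  exact ⟨⟨a m, m, rfl⟩, by rw [hx, h2]; exact hm⟩

end Henkin

/-! ### Countable models -/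

section Countable

variable {T : L.Theory}

theorem elementarilyEquivalent_of_isComplete (hT : T.IsComplete) (M : Type*) [L.Structure M]
    [M ⊨ T] [Nonempty M] (N : Type*) [L.Structure N] [N ⊨ T] [Nonempty N] : M ≅[L] N := by
  rw [elementarilyEquivalent_iff]
  intro φ
  rw [hT.realize_sentence_iff φ M, hT.realize_sentence_iff φ N]

theorem realize_existsSentence {ι : Type} [Finite ι] (φ : L.Formula ι) (A : Type*)
    [L.Structure A] :
    A ⊨ ((φ.relabel (Sum.inr : ι → Empty ⊕ ι)).iExs ι : L.Sentence) ↔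
      ∃ b : ι → A, φ.Realize b := by
  simp only [Sentence.Realize, Formula.realize_iExs, Formula.realize_relabel]
  exact Iff.rfl

/-- Elementarily equivalent models one of which is finite are isomorphic: an enumeration of the
finite one has the same type as some tuple in the other. -/
theorem nonempty_equiv_of_finite (hT : T.IsComplete) (M : Type*) [L.Structure M]
    [M ⊨ T] [Nonempty M] (N : Type*) [L.Structure N] [N ⊨ T] [Nonempty N] [Finite M] :
    Nonempty (M ≃[L] N) := by
  have hMN := elementarilyEquivalent_of_isComplete hT M N
  have hfin : Finite N := by
    by_contra h
    have : Infinite N := not_finite_iff_infinite.1 h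
    exact not_finite_iff_infinite.2 (hMN.infinite_iff.2 this) inferInstance
  have key : ∀ {ι : Type} [Finite ι] (φ : L.Formula ι) (a : ι → M), φ.Realize a →
      ∃ b : ι → N, φ.Realize b := by
    intro ι _ φ a ha
    exact (realize_existsSentence φ N).1
      ((hMN.realize_sentence _).1 ((realize_existsSentence φ M).2 ⟨a, ha⟩))
  obtain ⟨n, ⟨e⟩⟩ := Finite.exists_equiv_fin M
  have : ∃ b : Fin n → N, T.typeOf e.symm = T.typeOf b := by
    by_contra! hcon
    have : ∀ b : Fin n → N, ∃ φ : L.Formula (Fin n), φ.Realize e.symm ∧ ¬ φ.Realize b := by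
      intro b
      by_contra! h
      refine hcon b (typeOf_eq_iff.2 fun φ => ⟨h φ, fun hb => ?_⟩)
      by_contra ha
      exact h φ.not (Formula.realize_not.2 ha) hb
    choose φ h1 h2 using this
    obtain ⟨b, hb⟩ := key (Formula.iInf φ) e.symm (Formula.realize_iInf.2 h1)
    exact h2 b (Formula.realize_iInf.1 hb b)
  obtain ⟨b, hb⟩ := this
  refine (exists_equiv e.symm.surjective ?_ hb).nonempty
  -- `b` is onto, since the formula `∃ y, ⋀ i, xᵢ ≠ y` fails at the enumeration of `M`
  intro y
  by_contra! hy
  let ψ : L.Formula (Fin n) := Formula.iExs Unit (Formula.iInf fun i : Fin n =>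
    (Term.equal (Term.var (Sum.inl i)) (Term.var (Sum.inr ())) : L.Formula (Fin n ⊕ Unit)).not)
  obtain ⟨z, hz⟩ : ∃ z : Unit → M, ∀ i, e.symm i ≠ z () := by
    simpa [ψ] using (typeOf_eq_iff.1 hb ψ).2 (by simpa [ψ] using ⟨fun _ => y, hy⟩)
  exact hz (e (z ())) (e.symm_apply_apply _)

theorem exists_equiv_type_zero (M : Type w) [L.Structure M] [Countable M] :
    ∃ (N : Type) (_ : L.Structure N), Nonempty (M ≃[L] N) :=
  ⟨Shrink.{0} M, (equivShrink.{0} M).inducedStructure,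
    ⟨(equivShrink.{0} M).inducedStructureEquiv⟩⟩

theorem nonempty_equiv_of_countable (hT : T.IsComplete)
    (hcat : Cardinal.Categorical Cardinal.aleph0.{0} T) (M : Type*) [L.Structure M]
    [M ⊨ T] [Nonempty M] [Countable M] (N : Type*) [L.Structure N] [N ⊨ T] [Nonempty N]
    [Countable N] : Nonempty (M ≃[L] N) := by
  cases finite_or_infinite M with
  | inl h => exact nonempty_equiv_of_finite hT M N
  | inr h =>
    have : Infinite N := (elementarilyEquivalent_of_isComplete hT M N).infinite_iff.1 h
    obtain ⟨M', _, ⟨e⟩⟩ := exists_equiv_type_zero (L := L) M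
    obtain ⟨N', _, ⟨f⟩⟩ := exists_equiv_type_zero (L := L) N
    have : M' ⊨ T := StrongHomClass.theory_model e
    have : N' ⊨ T := StrongHomClass.theory_model f
    have : Infinite M' := e.toEquiv.infinite_iff.1 inferInstance
    have : Infinite N' := f.toEquiv.infinite_iff.1 inferInstance
    have : Countable M' := e.toEquiv.symm.injective.countable
    have : Countable N' := f.toEquiv.symm.injective.countable
    obtain ⟨g⟩ := hcat (Theory.ModelType.of T M') (Theory.ModelType.of T N')
      (Cardinal.mk_eq_aleph0 M') (Cardinal.mk_eq_aleph0 N')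
    exact ⟨f.symm.comp ((show M' ≃[L] N' from g).comp e)⟩

end Countable

/-! ### The space of Henkin types -/

section HenkinTypes

variable (T : L.Theory) (Φ : ∀ n : ℕ, L.Formula (Fin n ⊕ Unit))

/-- The closed set of all types in the variables `x₀, x₁, …` that contain `D_Φ`. -/
def henkinTypes : Set (T.CompleteType ℕ) :=
  {p | ∀ k, Formula.equivSentence (witnessFormula Φ k) ∈ p}

theorem isClosed_henkinTypes : IsClosed (henkinTypes T Φ) := by
  have : henkinTypes T Φ =
      ⋂ k, T.typesWith (Formula.equivSentence (witnessFormula Φ k)) := by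
    ext p
    simp [henkinTypes]
  rw [this]
  exact isClosed_iInter fun k => CompleteType.isClosed_typesWith _

variable {T Φ}

theorem typeOf_mem_henkinTypes {M : Type*} [L.Structure M] [Nonempty M] [M ⊨ T] {a : ℕ → M} :
    T.typeOf a ∈ henkinTypes T Φ ↔ IsHenkin Φ a :=
  forall_congr' fun _ => Theory.CompleteType.formula_mem_typeOf

instance : CompactSpace (henkinTypes T Φ) :=
  isCompact_iff_compactSpace.1 (isClosed_henkinTypes T Φ).isCompact

/-- The sets of types containing a given formula form a basis of the type space. -/
theorem exists_formula_of_mem_nhds {α : Type*} {p : T.CompleteType α} {U : Set (T.CompleteType α)}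
    (hU : U ∈ 𝓝 p) : ∃ φ : L.Formula α, Formula.equivSentence φ ∈ p ∧
      ∀ q : T.CompleteType α, Formula.equivSentence φ ∈ q → q ∈ U := by
  obtain ⟨_, ⟨φ, rfl⟩, h1, h2⟩ :=
    CompleteType.isTopologicalBasis_range_typesWith.mem_nhds_iff.1 hU
  exact ⟨Formula.equivSentence.symm φ, by simpa using h1, fun q hq => h2 (by simpa using hq)⟩

theorem eventually_formula_mem {α : Type*} {p : T.CompleteType α} {φ : L.Formula α}
    (h : Formula.equivSentence φ ∈ p) :
    ∀ᶠ q in 𝓝 p, Formula.equivSentence φ ∈ q :=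
  (CompleteType.isOpen_typesWith (T := T) (Formula.equivSentence φ)).mem_nhds h

/-- Every Henkin sequence, in any model of `T`, has the type of an enumeration of `M`. -/
theorem exists_surjective_typeOf_eq (hT : T.IsComplete)
    (hcat : Cardinal.Categorical Cardinal.aleph0.{0} T) (M : Type w) [L.Structure M] [M ⊨ T]
    [Countable M] [Nonempty M] (hΦ : IsRich Φ) {N : Type*} [L.Structure N] [N ⊨ T] [Nonempty N]
    {a : ℕ → N} (ha : IsHenkin Φ a) :
    ∃ b : ℕ → M, Function.Surjective b ∧ T.typeOf b = T.typeOf a := by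
  obtain ⟨S, hS⟩ := hΦ.exists_elementarySubstructure ha
  have : Countable S := by
    have : Countable (S : Set N) := by rw [hS]; exact (countable_range a).to_subtype
    exact this
  obtain ⟨e⟩ := nonempty_equiv_of_countable (T := T) hT hcat S M
  have haS : ∀ n, a n ∈ S := fun n => by
    rw [← SetLike.mem_coe, hS]; exact ⟨n, rfl⟩
  refine ⟨fun n => e ⟨a n, haS n⟩, ?_, ?_⟩
  · refine e.surjective.comp fun x => ?_
    have hx : (x : N) ∈ (S : Set N) := x.2
    rw [hS] at hx
    obtain ⟨n, hn⟩ := hx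
    exact ⟨n, Subtype.ext hn⟩
  · rw [typeOf_comp_equiv e fun n => (⟨a n, haS n⟩ : S), typeOf_eq_iff]
    exact fun φ => (S.subtype.map_formula φ _).symm

theorem exists_surjective_of_mem_henkinTypes (hT : T.IsComplete)
    (hcat : Cardinal.Categorical Cardinal.aleph0.{0} T) (M : Type w) [L.Structure M] [M ⊨ T]
    [Countable M] [Nonempty M] (hΦ : IsRich Φ)
    {p : T.CompleteType ℕ} (hp : p ∈ henkinTypes T Φ) :
    ∃ b : ℕ → M, Function.Surjective b ∧ T.typeOf b = p := by
  obtain ⟨N, a, rfl⟩ := Theory.exists_modelType_is_realized_in T p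
  exact exists_surjective_typeOf_eq hT hcat M hΦ (typeOf_mem_henkinTypes.1 hp)

end HenkinTypes

/-! ### Atomicity -/

section Atomic

variable {T : L.Theory} {Φ : ∀ n : ℕ, L.Formula (Fin n ⊕ Unit)}
  {M : Type w} [L.Structure M] [M ⊨ T] [Nonempty M]

theorem typeOf_eq_of_imp {α : Type*} {a b : α → M}
    (h : ∀ φ : L.Formula α, φ.Realize a → φ.Realize b) : T.typeOf a = T.typeOf b := by
  refine typeOf_eq_iff.2 fun φ => ⟨h φ, fun hb => ?_⟩
  by_contra ha
  exact h φ.not (Formula.realize_not.2 ha) hb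

theorem typeOf_comp_eq {α β : Type*} {a b : α → M} (h : T.typeOf a = T.typeOf b) (f : β → α) :
    T.typeOf (a ∘ f) = T.typeOf (b ∘ f) := by
  rw [typeOf_eq_iff] at h ⊢
  intro φ
  rw [← Formula.realize_relabel, ← Formula.realize_relabel]
  exact h _

theorem typeOf_eq_of_initial {a b : ℕ → M}
    (h : ∀ n, T.typeOf (fun i : Fin n => a i) = T.typeOf fun i : Fin n => b i) :
    T.typeOf a = T.typeOf b := by
  refine typeOf_eq_of_imp fun φ ha => ?_
  obtain ⟨m, hm⟩ := exists_realize_congr M φ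
  have key : ∀ a : ℕ → M, φ.Realize a ↔
      (φ.relabel fun n => Fin.clamp n m).Realize fun i : Fin (m + 1) => a i := by
    intro a
    rw [Formula.realize_relabel]
    exact hm _ _ fun i hi => by simp [hi.le]
  exact (key b).2 ((typeOf_eq_iff.1 (h (m + 1)) _).1 ((key a).1 ha))

theorem nonempty_henkinTypes (T : L.Theory) (Φ : ∀ n : ℕ, L.Formula (Fin n ⊕ Unit))
    (M : Type w) [L.Structure M] [M ⊨ T] [Nonempty M] : Nonempty (henkinTypes T Φ) :=
  ⟨⟨T.typeOf (henkinSeq Φ (fun _ => Classical.arbitrary M) 0),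
    typeOf_mem_henkinTypes.2 (isHenkin_henkinSeq Φ _ 0 fun _ h => absurd h (Nat.not_lt_zero _))⟩⟩

/-- If all Henkin types are types of enumerations of `M`, then `M` is atomic.  The compact space of
Henkin types is the union over `i` of the closed sets of those types in which the variables
`i : ι → ℕ` have the type of `c`.  By Baire's theorem one of them contains a nonempty open set,
given by a formula `φ`; the type of `c` is then isolated by the formula that says that `c` occurs at
the places `i` of a tuple that satisfies `φ` and finitely many conditions from `D_Φ`. -/
theorem exists_isolating_formula
    (hM : ∀ p ∈ henkinTypes T Φ, ∃ b : ℕ → M, Function.Surjective b ∧ T.typeOf b = p)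
    {ι : Type} [Finite ι] (c : ι → M) :
    ∃ θ : L.Formula ι, θ.Realize c ∧ ∀ d : ι → M, θ.Realize d → T.typeOf c = T.typeOf d := by
  have := nonempty_henkinTypes T Φ M
  let F : (ι → ℕ) → Set (henkinTypes T Φ) := fun i =>
    {p | ∀ φ : L.Formula ι, φ.Realize c → Formula.equivSentence (φ.relabel i) ∈ p.1}
  have hF : ∀ (i : ι → ℕ) (b : ℕ → M) (hb : T.typeOf b ∈ henkinTypes T Φ),
      (⟨T.typeOf b, hb⟩ : henkinTypes T Φ) ∈ F i ↔ T.typeOf c = T.typeOf (b ∘ i) := by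
    intro i b hb
    have : (⟨T.typeOf b, hb⟩ : henkinTypes T Φ) ∈ F i ↔
        ∀ φ : L.Formula ι, φ.Realize c → φ.Realize (b ∘ i) :=
      forall₂_congr fun φ _ => Theory.CompleteType.formula_mem_typeOf.trans Formula.realize_relabel
    rw [this]
    exact ⟨typeOf_eq_of_imp, fun h φ => (typeOf_eq_iff.1 h φ).1⟩
  have hclosed : ∀ i, IsClosed (F i) := by
    intro i
    simp only [F, ofPred_forall]
    exact isClosed_iInter fun φ => isClosed_iInter fun _ =>
      (CompleteType.isClosed_typesWith (T := T) (Formula.equivSentence (φ.relabel i))).preimage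
        continuous_subtype_val
  have hunion : ⋃ i, F i = univ := by
    refine eq_univ_of_forall fun p => mem_iUnion.2 ?_
    obtain ⟨p, hp⟩ := p
    obtain ⟨b, hb, rfl⟩ := hM p hp
    choose i hi using fun j => hb (c j)
    refine ⟨i, (hF i b hp).2 ?_⟩
    rw [show b ∘ i = c from funext hi]
  obtain ⟨i, ⟨p, hp⟩, hpi⟩ := nonempty_interior_of_iUnion_of_closed hclosed hunion
  obtain ⟨b, -, rfl⟩ := hM p hp
  have hcb : T.typeOf c = T.typeOf (b ∘ i) := (hF i b hp).1 (interior_subset hpi)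
  rw [mem_interior_iff_mem_nhds, nhds_subtype_eq_comap, mem_comap] at hpi
  obtain ⟨U, hU, hUF⟩ := hpi
  obtain ⟨φ, hφb, hφU⟩ := exists_formula_of_mem_nhds hU
  rw [Theory.CompleteType.formula_mem_typeOf] at hφb
  obtain ⟨m₀, hm₀⟩ := exists_realize_congr M φ
  obtain ⟨m₁, hm₁⟩ := (finite_range i).bddAbove
  let m := max m₀ m₁
  have him : ∀ j, i j ≤ m := fun j => (hm₁ ⟨j, rfl⟩).trans (le_max_right _ _)
  -- `g` truncates indices, so that `x ∘ g` is a sequence that extends the tuple `x`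
  let g : ℕ → Fin (m + 1) := fun n => Fin.clamp n m
  let θ : L.Formula ι := Formula.iExs (Fin (m + 1))
    ((φ.relabel (Sum.inr ∘ g) ⊓
      Formula.iInf fun k : Fin (m + 1) => (witnessFormula Φ k).relabel (Sum.inr ∘ g)) ⊓
      Formula.iInf fun j : ι => Term.equal (Term.var (Sum.inl j)) (Term.var (Sum.inr (g (i j)))))
  have hθ : ∀ d : ι → M, θ.Realize d ↔ ∃ x : Fin (m + 1) → M, (φ.Realize (x ∘ g) ∧
      ∀ k : Fin (m + 1), (witnessFormula Φ k).Realize (x ∘ g)) ∧ ∀ j, d j = x (g (i j)) := by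
    intro d
    simp only [θ, Formula.realize_iExs, Formula.realize_inf, Formula.realize_iInf,
      Formula.realize_relabel, ← Function.comp_assoc, Sum.elim_comp_inr, Formula.realize_equal,
      Term.realize_var, Sum.elim_inl, Sum.elim_inr]
  have hg : ∀ (x : ℕ → M), ∀ n ≤ m, x (g n) = x n := fun x n hn => by simp [g, hn]
  refine ⟨θ, (typeOf_eq_iff.1 hcb θ).2 ((hθ _).2 ⟨fun n => b n, ⟨?_, fun k => ?_⟩, fun j => ?_⟩),
    fun d hd => ?_⟩
  · exact (hm₀ _ _ fun n hn => hg b n (hn.le.trans (le_max_left _ _))).2 hφb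
  · refine (realize_witnessFormula_congr Φ fun n hn => ?_).2 (typeOf_mem_henkinTypes.1 hp k)
    exact hg b n (hn.trans (Nat.le_of_lt_succ k.2))
  · exact (hg b _ (him j)).symm
  · obtain ⟨x, ⟨hx1, hx2⟩, hx3⟩ := (hθ d).1 hd
    have ha := isHenkin_henkinSeq Φ (x ∘ g) (m + 1) fun k hk => hx2 ⟨k, hk⟩
    have hag : ∀ n ≤ m, henkinSeq Φ (x ∘ g) (m + 1) n = x (g n) := fun n hn =>
      henkinSeq_of_lt Φ _ (Nat.lt_succ_of_le hn)
    have h := (hF i _ (typeOf_mem_henkinTypes.2 ha)).1 (hUF (hφU _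
      (Theory.CompleteType.formula_mem_typeOf.2
        ((hm₀ _ _ fun n hn => hag n (hn.le.trans (le_max_left _ _))).2 hx1))))
    rw [h]
    congr 1
    exact funext fun j => (hag _ (him j)).trans (hx3 j).symm

end Atomic

/-! ### A continuous choice of enumerations -/

section Section

variable {T : L.Theory} {Φ : ∀ n : ℕ, L.Formula (Fin n ⊕ Unit)}
  {M : Type w} [L.Structure M] [M ⊨ T] [Nonempty M]

/-- Back and forth: if `c` and the Henkin sequence `r` agree in type below `n`, then `c` may be
modified from `n` on so as to agree in type with `r` below `K + 1`, and to take a prescribed value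
`m` at `K`.  As `K` is found from the formula that isolates the type of `c₀, …, cₙ₋₁, m`, it does
not depend on `r`. -/
theorem exists_extension_step (hΦ : IsRich Φ)
    (hM : ∀ p ∈ henkinTypes T Φ, ∃ b : ℕ → M, Function.Surjective b ∧ T.typeOf b = p)
    (n : ℕ) (c : ℕ → M) (m : M) :
    ∃ K ≥ n, ∀ r : ℕ → M, IsHenkin Φ r →
      T.typeOf (fun i : Fin n => c i) = T.typeOf (fun i : Fin n => r i) →
      ∃ c' : ℕ → M, (∀ i < n, c' i = c i) ∧ c' K = m ∧
        T.typeOf (fun i : Fin (K + 1) => c' i) = T.typeOf fun i : Fin (K + 1) => r i := by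
  obtain ⟨θ, hθ, hθ'⟩ := exists_isolating_formula hM
    (Sum.elim (fun i : Fin n => c i) fun _ : Unit => m)
  obtain ⟨K, hK, h⟩ := hΦ.exists_witness θ
  refine ⟨K, hK, fun r hr hcr => ?_⟩
  have h1 : (θ.iExs Unit).Realize fun i : Fin n => r i :=
    (typeOf_eq_iff.1 hcr _).1 (Formula.realize_iExs.2 ⟨_, hθ⟩)
  obtain ⟨y, hy⟩ := Formula.realize_iExs.1 h1
  have h2 := hθ' _ (h hr (y ()) hy)
  -- the terms `r i` for `i < n` and `r K` occur twice in the following tuple; the equations between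
  -- the copies force the tuple `x` below to extend `c₀, …, cₙ₋₁` and to take the value `m` at `K`
  obtain ⟨χ, hχ, hχ'⟩ := exists_isolating_formula hM
    (Sum.elim (Sum.elim (fun i : Fin n => r i) fun _ : Unit => r K) fun i : Fin (K + 1) => r i)
  obtain ⟨x, hx⟩ := Formula.realize_iExs.1
    ((typeOf_eq_iff.1 h2 _).2 (Formula.realize_iExs.2 ⟨_, hχ⟩))
  have h3 := hχ' _ hx
  have heq : ∀ i j, Sum.elim (Sum.elim (fun i : Fin n => r i) fun _ : Unit => r K)
        (fun i : Fin (K + 1) => r i) i =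
      Sum.elim (Sum.elim (fun i : Fin n => r i) fun _ : Unit => r K)
        (fun i : Fin (K + 1) => r i) j →
      Sum.elim (Sum.elim (fun i : Fin n => c i) fun _ : Unit => m) x i =
        Sum.elim (Sum.elim (fun i : Fin n => c i) fun _ : Unit => m) x j := fun i j h => by
    simpa using (typeOf_eq_iff.1 h3 (Term.equal (Term.var i) (Term.var j))).1 (by simpa using h)
  refine ⟨fun i => x (Fin.clamp i K), fun i hi => ?_, ?_, ?_⟩
  · refine heq (.inr _) (.inl (.inl ⟨i, hi⟩)) ?_
    simp [(hi.le.trans hK)]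
  · exact heq (.inr _) (.inl (.inr ())) (by simp)
  · have h4 := typeOf_comp_eq h3 (Sum.inr : Fin (K + 1) → _)
    rw [Sum.elim_comp_inr, Sum.elim_comp_inr] at h4
    rw [h4]
    congr 1
    funext i
    exact congrArg x (Fin.ext (by simp [Nat.le_of_lt_succ i.2]))

/-- Every Henkin type is the type of an enumeration of `M` whose terms depend on the type in a
locally constant way. -/
theorem exists_continuous_enumeration [Countable M] (hΦ : IsRich Φ)
    (hM : ∀ p ∈ henkinTypes T Φ, ∃ b : ℕ → M, Function.Surjective b ∧ T.typeOf b = p) :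
    ∃ s : henkinTypes T Φ → ℕ → M, (∀ p, Function.Surjective (s p)) ∧
      (∀ p, T.typeOf (s p) = p) ∧ ∀ n p, ∀ᶠ q in 𝓝 p, s q n = s p n := by
  classical
  choose r hr hrp using fun p : henkinTypes T Φ => hM p p.2
  have hH : ∀ p, IsHenkin Φ (r p) := fun p => typeOf_mem_henkinTypes.1 (by rw [hrp]; exact p.2)
  obtain ⟨e, he⟩ := exists_surjective_nat M
  choose K hK hstep using exists_extension_step hΦ hM
  -- the pair `(n, c)` stands for the initial segment of length `n` of the enumeration; `c` is
  -- chosen in terms of the set of admissible `c` alone, which makes the choice locally constant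
  let S : henkinTypes T Φ → ℕ → ℕ × (ℕ → M) := fun p j => Nat.rec (0, fun _ => e 0) (fun j x =>
    (K x.1 x.2 (e j) + 1, Classical.epsilon fun c' : ℕ → M => (∀ i < x.1, c' i = x.2 i) ∧
      c' (K x.1 x.2 (e j)) = e j ∧ T.typeOf (fun i : Fin (K x.1 x.2 (e j) + 1) => c' i) =
        T.typeOf fun i : Fin (K x.1 x.2 (e j) + 1) => r p i)) j
  have hS1 : ∀ p j, T.typeOf (fun i : Fin (S p j).1 => (S p j).2 i) =
      T.typeOf fun i : Fin (S p j).1 => r p i := by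
    intro p j
    induction j with
    | zero => exact congrArg _ (funext fun i => i.elim0)
    | succ j ih => exact (Classical.epsilon_spec (hstep _ _ (e j) _ (hH p) ih)).2.2
  have hS2 : ∀ p j, (∀ i < (S p j).1, (S p (j + 1)).2 i = (S p j).2 i) ∧
      (S p (j + 1)).2 (K (S p j).1 (S p j).2 (e j)) = e j := fun p j =>
    ⟨(Classical.epsilon_spec (hstep _ _ (e j) _ (hH p) (hS1 p j))).1,
      (Classical.epsilon_spec (hstep _ _ (e j) _ (hH p) (hS1 p j))).2.1⟩
  have hS3 : ∀ p j, (S p (j + 1)).1 = K (S p j).1 (S p j).2 (e j) + 1 := fun _ _ => rfl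
  have hmono : ∀ p, StrictMono fun j => (S p j).1 := fun p => strictMono_nat_of_lt_succ fun j => by
    rw [hS3]; exact Nat.lt_succ_of_le (hK _ _ _)
  have hagree : ∀ p j k, j ≤ k → ∀ i < (S p j).1, (S p k).2 i = (S p j).2 i := by
    intro p j k hjk
    induction k, hjk using Nat.le_induction with
    | base => exact fun _ _ => rfl
    | succ k hk ih =>
      intro i hi
      rw [(hS2 p k).1 i (hi.trans_le ((hmono p).monotone hk)), ih i hi]
  let s : henkinTypes T Φ → ℕ → M := fun p i => (S p (i + 1)).2 i
  have hs : ∀ p j, ∀ i < (S p j).1, s p i = (S p j).2 i := by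
    intro p j i hi
    obtain h | h := le_total (i + 1) j
    · exact (hagree p _ _ h i ((hmono p).le_apply)).symm
    · exact hagree p _ _ h i hi
  have hloc : ∀ N p, ∀ᶠ q in 𝓝 p,
      T.typeOf (fun i : Fin N => r q i) = T.typeOf fun i : Fin N => r p i := by
    intro N p
    obtain ⟨θ, h1, h2⟩ := exists_isolating_formula hM fun i : Fin N => r p i
    have h3 : ∀ q : henkinTypes T Φ, Formula.equivSentence (θ.relabel Fin.val) ∈ q.1 ↔
        θ.Realize fun i : Fin N => r q i := by
      intro q
      rw [← hrp q, Theory.CompleteType.formula_mem_typeOf, Formula.realize_relabel]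
      exact Iff.rfl
    have h4 := continuous_subtype_val.continuousAt (x := p)
      |>.eventually (eventually_formula_mem ((h3 p).2 h1))
    filter_upwards [h4] with q hq
    exact (h2 _ ((h3 q).1 hq)).symm
  have hSloc : ∀ j p, ∀ᶠ q in 𝓝 p, S q j = S p j := by
    intro j p
    induction j with
    | zero => exact Eventually.of_forall fun _ => rfl
    | succ j ih =>
      filter_upwards [ih, hloc (S p (j + 1)).1 p] with q hq1 hq2
      rw [hS3] at hq2
      simp only [S] at hq1 hq2 ⊢
      rw [hq1, hq2]
  refine ⟨s, fun p m => ?_, fun p => ?_, fun n p => ?_⟩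
  · obtain ⟨j, rfl⟩ := he m
    exact ⟨K (S p j).1 (S p j).2 (e j),
      (hs p (j + 1) _ (by rw [hS3]; exact Nat.lt_succ_self _)).trans (hS2 p j).2⟩
  · rw [← hrp p]
    refine typeOf_eq_of_initial fun n => ?_
    have h1 := typeOf_comp_eq (hS1 p n) (Fin.castLE ((hmono p).le_apply (x := n)))
    rw [show (fun i : Fin n => s p i) = (fun i : Fin (S p n).1 => (S p n).2 i) ∘
      Fin.castLE ((hmono p).le_apply (x := n)) from
      funext fun i => hs p n i (i.2.trans_le (hmono p).le_apply)]
    exact h1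
  · filter_upwards [hSloc (n + 1) p] with q hq
    simp only [s, hq]

/-- The space of Henkin types has no isolated points: the variable `x_K` is subject to no condition
when `Φ K` is `⊤`, so it may be taken equal to `x₀` or not. -/
theorem nontrivial_of_isOpen_henkinTypes [Nontrivial M] (hΦ : IsRich Φ)
    (hM : ∀ p ∈ henkinTypes T Φ, ∃ b : ℕ → M, Function.Surjective b ∧ T.typeOf b = p)
    {U : Set (henkinTypes T Φ)} (hU : IsOpen U) (hne : U.Nonempty) : U.Nontrivial := by
  obtain ⟨⟨p, hp⟩, hpU⟩ := hne
  obtain ⟨b, -, rfl⟩ := hM p hp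
  have hpU := hU.mem_nhds hpU
  rw [nhds_subtype_eq_comap, mem_comap] at hpU
  obtain ⟨W, hW, hWU⟩ := hpU
  obtain ⟨φ, hφb, hφU⟩ := exists_formula_of_mem_nhds hW
  rw [Theory.CompleteType.formula_mem_typeOf] at hφb
  obtain ⟨m, hm⟩ := exists_realize_congr M φ
  obtain ⟨K, hK, hKtop⟩ := hΦ (m + 1) ⊤
  let a : M → ℕ → M := fun y => henkinSeq Φ (Function.update b K y) (K + 1)
  have hab : ∀ y, ∀ i < K, a y i = b i := fun y i hi =>
    (henkinSeq_of_lt Φ _ (hi.trans K.lt_succ_self)).trans (Function.update_of_ne hi.ne _ _)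
  have haK : ∀ y, a y K = y := fun y =>
    (henkinSeq_of_lt Φ _ K.lt_succ_self).trans (Function.update_self _ _ _)
  have ha : ∀ y, IsHenkin Φ (a y) := by
    intro y
    refine isHenkin_henkinSeq Φ _ _ fun k hk => ?_
    obtain hk | rfl := Nat.lt_succ_iff_lt_or_eq.1 hk
    · refine (realize_witnessFormula_congr Φ fun i hi => ?_).2 (typeOf_mem_henkinTypes.1 hp k)
      exact Function.update_of_ne (hi.trans_lt hk).ne _ _
    · rw [realize_witnessFormula, hKtop]
      simp [Formula.realize_relabel]
  have haU : ∀ y, (⟨T.typeOf (a y), typeOf_mem_henkinTypes.2 (ha y)⟩ : henkinTypes T Φ) ∈ U :=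
    fun y => hWU (hφU _ (Theory.CompleteType.formula_mem_typeOf.2
      ((hm _ _ fun i hi => hab y i (hi.trans (Nat.lt_of_succ_le hK))).2 hφb)))
  obtain ⟨y, hy⟩ := exists_ne (b 0)
  refine ⟨_, haU (b 0), _, haU y, fun h => hy ?_⟩
  have h0 : 0 < K := lt_of_lt_of_le m.succ_pos hK
  have := (typeOf_eq_iff.1 (congrArg Subtype.val h) (Term.equal (Term.var 0) (Term.var K))).1
    (by simp [hab _ 0 h0, haK])
  simpa [hab _ 0 h0, haK] using this.symm

theorem nonempty_henkinTypes_homeomorph_cantor [Countable L.Symbols] [Nontrivial M]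
    (hΦ : IsRich Φ)
    (hM : ∀ p ∈ henkinTypes T Φ, ∃ b : ℕ → M, Function.Surjective b ∧ T.typeOf b = p) :
    Nonempty (henkinTypes T Φ ≃ₜ (ℕ → Bool)) := by
  have := nonempty_henkinTypes T Φ M
  have : Nonempty (L.Formula ℕ) := ⟨⊤⟩
  obtain ⟨e, he⟩ := exists_surjective_nat (L.Formula ℕ)
  refine nonempty_homeomorph_cantor
    (fun n => {p : henkinTypes T Φ | Formula.equivSentence (e n) ∈ p.1})
    (fun n => (CompleteType.isClopen_typesWith (T := T) (Formula.equivSentence (e n))).preimage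
      continuous_subtype_val) (fun p q h => Subtype.ext (SetLike.ext fun φ => ?_))
    fun U => nontrivial_of_isOpen_henkinTypes hΦ hM
  obtain ⟨n, hn⟩ := he (Formula.equivSentence.symm φ)
  simpa [hn] using h n

end Section

/-! ### The groupoid in terms of enumerations of one model -/

open PartialGroupoid

section Enumerations

variable {T : L.Theory} {Φ : ∀ n : ℕ, L.Formula (Fin n ⊕ Unit)}
  {M : Type w} [L.Structure M] [M ⊨ T] [Nonempty M]

theorem typeOf_sumElim_comp_equiv {N : Type*} [L.Structure N] [N ⊨ T] [Nonempty N] (e : M ≃[L] N)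
    (a b : ℕ → M) :
    T.typeOf (Sum.elim (fun i => e (a i)) fun i => e (b i)) = T.typeOf (Sum.elim a b) := by
  rw [← typeOf_comp_equiv e (Sum.elim a b)]
  congr 1
  funext i
  cases i <;> rfl

/-- The element `tp(a, b)` of `G₀(T)`, for two enumerations of a model in an arbitrary universe. -/
def G0.mk [Countable M] {a b : ℕ → M} (ha : Function.Surjective a) (hb : Function.Surjective b) :
    G0 T :=
  ⟨T.typeOf (Sum.elim a b), by
    obtain ⟨N, _, ⟨e⟩⟩ := exists_equiv_type_zero (L := L) M
    have : N ⊨ T := StrongHomClass.theory_model e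
    have : Nonempty N := e.toEquiv.symm.nonempty
    exact ⟨Theory.ModelType.of T N, fun i => e (a i), fun i => e (b i), e.surjective.comp ha,
      e.surjective.comp hb, typeOf_sumElim_comp_equiv e a b⟩⟩

variable [Countable M] {a b c : ℕ → M}

theorem G0.isMul_mk (ha : Function.Surjective a) (hb : Function.Surjective b)
    (hc : Function.Surjective c) :
    G0.IsMul (G0.mk (T := T) ha hb) (G0.mk hb hc) (G0.mk ha hc) := by
  obtain ⟨N, _, ⟨e⟩⟩ := exists_equiv_type_zero (L := L) M
  have : N ⊨ T := StrongHomClass.theory_model e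
  have : Nonempty N := e.toEquiv.symm.nonempty
  exact ⟨Theory.ModelType.of T N, fun i => e (a i), fun i => e (b i), fun i => e (c i),
    e.surjective.comp ha, e.surjective.comp hb, e.surjective.comp hc,
    typeOf_sumElim_comp_equiv e a b, typeOf_sumElim_comp_equiv e b c,
    typeOf_sumElim_comp_equiv e a c⟩

theorem G0.isInv_mk (ha : Function.Surjective a) (hb : Function.Surjective b) :
    G0.IsInv (G0.mk (T := T) ha hb) (G0.mk hb ha) := by
  obtain ⟨N, _, ⟨e⟩⟩ := exists_equiv_type_zero (L := L) M
  have : N ⊨ T := StrongHomClass.theory_model e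
  have : Nonempty N := e.toEquiv.symm.nonempty
  exact ⟨Theory.ModelType.of T N, fun i => e (a i), fun i => e (b i),
    e.surjective.comp ha, e.surjective.comp hb,
    typeOf_sumElim_comp_equiv e a b, typeOf_sumElim_comp_equiv e b a⟩

theorem G0.pmul_mk (ha : Function.Surjective a) (hb : Function.Surjective b)
    (hc : Function.Surjective c) :
    pmul (G0.mk (T := T) ha hb) (G0.mk hb hc) = Part.some (G0.mk ha hc) :=
  Part.eq_some_iff.2 (G0.mem_mul.2 (G0.isMul_mk ha hb hc))

theorem G0.pinv_mk (ha : Function.Surjective a) (hb : Function.Surjective b) :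
    pinv (G0.mk (T := T) ha hb) = G0.mk hb ha :=
  G0.inv_eq_iff.2 (G0.isInv_mk ha hb)

theorem G0.src_mk (ha : Function.Surjective a) (hb : Function.Surjective b) :
    src (G0.mk (T := T) ha hb) = G0.mk hb hb :=
  (mem_src.1 (by rw [G0.pinv_mk, G0.pmul_mk hb ha hb]; exact Part.mem_some _)).symm

theorem G0.tgt_mk (ha : Function.Surjective a) (hb : Function.Surjective b) :
    tgt (G0.mk (T := T) ha hb) = G0.mk ha ha :=
  (mem_tgt.1 (by rw [G0.pinv_mk, G0.pmul_mk ha hb ha]; exact Part.mem_some _)).symm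

theorem G0.mk_self_mem_BPhi (ha : Function.Surjective a) :
    G0.mk ha ha ∈ BPhi T Φ ↔ IsHenkin Φ a := by
  refine (and_iff_right (G0.pmul_mk ha ha ha)).trans (forall_congr' fun k => ?_)
  exact Theory.CompleteType.formula_mem_typeOf.trans Formula.realize_relabel

/-- If the composition of `g = tp(a, b)` and `h = tp(b', c)` is defined, then `b` and `b'` have the
same type. -/
theorem G0.typeOf_eq_of_dom {b' : ℕ → M} (ha : Function.Surjective a) (hb : Function.Surjective b)
    (hb' : Function.Surjective b') (hc : Function.Surjective c)
    (h : (pmul (G0.mk (T := T) ha hb) (G0.mk hb' hc)).Dom) : T.typeOf b = T.typeOf b' := by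
  obtain ⟨-, N, x, y, z, -, -, -, h1, h2, -⟩ := h
  rw [typeOf_eq_iff]
  intro φ
  have e1 := typeOf_eq_iff.1 h1 (φ.relabel Sum.inr)
  have e2 := typeOf_eq_iff.1 h2 (φ.relabel Sum.inl)
  simp only [Formula.realize_relabel, Sum.elim_comp_inr, Sum.elim_comp_inl] at e1 e2
  exact e1.symm.trans e2

end Enumerations

/-! ### The isomorphism -/

section Isomorphism

variable {T : L.Theory} {Φ : ∀ n : ℕ, L.Formula (Fin n ⊕ Unit)}
  {M : Type w} [L.Structure M] [M ⊨ T] [Nonempty M] [Countable M]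
  {B : Type*}

/-- The map that sends `(x, σ, y)` to `tp(s x, σ (s y))`, for a family `s` of enumerations of `M`
that satisfy `D_Φ`. -/
def ofTrivial {s : B → ℕ → M} (hs : ∀ x, Function.Surjective (s x)) (hH : ∀ x, IsHenkin Φ (s x))
    (p : Trivial B (M ≃[L] M)) : GPhi T Φ :=
  ⟨G0.mk (hs p.1) (p.2.1.surjective.comp (hs p.2.2)), by
    rw [G0.src_mk, G0.tgt_mk, G0.mk_self_mem_BPhi, G0.mk_self_mem_BPhi]
    exact ⟨fun k => (StrongHomClass.realize_formula p.2.1 _).2 (hH _ k), hH _⟩⟩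

variable {s : B → ℕ → M}

theorem pmul_ofTrivial (hs : ∀ x, Function.Surjective (s x)) (hH : ∀ x, IsHenkin Φ (s x))
    (hinj : ∀ x y, T.typeOf (s x) = T.typeOf (s y) → x = y) (p q : Trivial B (M ≃[L] M)) :
    pmul (ofTrivial (T := T) hs hH p) (ofTrivial hs hH q) =
      (pmul p q).map (ofTrivial (T := T) hs hH) := by
  obtain ⟨x, σ, y⟩ := p
  obtain ⟨y', τ, z⟩ := q
  by_cases h : y = y'
  · subst h
    have h1 : pmul (G := Trivial B (M ≃[L] M)) (x, σ, y) (y, τ, z) = Part.some (x, σ * τ, z) :=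
      Part.eq_some_iff.2 ⟨rfl, rfl⟩
    refine (Part.eq_some_iff.2 (Restrict.mem_pmul.2 ?_)).trans
      ((congrArg (Part.map (ofTrivial (T := T) hs hH)) h1).trans (Part.map_some _ _)).symm
    have h2 : (ofTrivial (T := T) hs hH (y, τ, z)).1 =
        G0.mk (σ.surjective.comp (hs y)) (σ.surjective.comp (τ.surjective.comp (hs z))) :=
      Subtype.ext (typeOf_sumElim_comp_equiv σ (s y) (τ ∘ s z)).symm
    rw [h2]
    exact G0.mem_mul.2 (G0.isMul_mk (hs x) (σ.surjective.comp (hs y))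
      (σ.surjective.comp (τ.surjective.comp (hs z))))
  · have h1 : ¬ (pmul (G := Trivial B (M ≃[L] M)) (x, σ, y) (y', τ, z)).Dom := h
    have h2 : ¬ (pmul (ofTrivial (T := T) hs hH (x, σ, y)) (ofTrivial hs hH (y', τ, z))).Dom := by
      intro hd
      refine h (hinj y y' ?_)
      rw [← typeOf_comp_equiv σ (s y)]
      exact G0.typeOf_eq_of_dom (hs x) (σ.surjective.comp (hs y)) (hs y')
        (τ.surjective.comp (hs z)) hd
    exact (Part.eq_none_iff'.2 h2).trans
      (((congrArg _ (Part.eq_none_iff'.2 h1)).trans (Part.map_none _)).symm)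

theorem bijective_ofTrivial (hs : ∀ x, Function.Surjective (s x)) (hH : ∀ x, IsHenkin Φ (s x))
    (hinj : ∀ x y, T.typeOf (s x) = T.typeOf (s y) → x = y)
    (hsurj : ∀ p ∈ henkinTypes T Φ, ∃ x, T.typeOf (s x) = p)
    (hM : ∀ (N : Theory.ModelType.{u, v, 0} T), Countable N → Nonempty (M ≃[L] N)) :
    Function.Bijective (ofTrivial (T := T) hs hH) := by
  constructor
  · rintro ⟨x, σ, y⟩ ⟨x', τ, y'⟩ h
    have h : T.typeOf (Sum.elim (s x) (σ ∘ s y)) = T.typeOf (Sum.elim (s x') (τ ∘ s y')) :=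
      congrArg (fun g => g.1.1) h
    obtain rfl := hinj x x' (typeOf_comp_eq h Sum.inl)
    obtain rfl : y = y' := by
      have : T.typeOf (fun i => σ (s y i)) = T.typeOf fun i => τ (s y' i) :=
        typeOf_comp_eq h Sum.inr
      rw [typeOf_comp_equiv, typeOf_comp_equiv] at this
      exact hinj y y' this
    have : σ = τ := by
      ext m
      obtain ⟨j, rfl⟩ := hs y m
      obtain ⟨i, hi⟩ := hs x (σ (s y j))
      have h1 := (typeOf_eq_iff.1 h (Term.equal (Term.var (.inl i)) (Term.var (.inr j)))).1
        (by simpa using hi)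
      rw [← hi]
      simpa using h1
    rw [this]
  · rintro ⟨⟨g, N, a, b, ha, hb, rfl⟩, hg⟩
    have hN : Countable N := ha.countable
    obtain ⟨e⟩ := hM N hN
    have hab : (⟨pairType a b, N, a, b, ha, hb, rfl⟩ : G0 T) = G0.mk ha hb := rfl
    simp only [hab, G0.src_mk, G0.tgt_mk, G0.mk_self_mem_BPhi] at hg
    obtain ⟨x, hx⟩ := hsurj (T.typeOf a) (typeOf_mem_henkinTypes.2 hg.2)
    obtain ⟨y, hy⟩ := hsurj (T.typeOf b) (typeOf_mem_henkinTypes.2 hg.1)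
    obtain ⟨σ, hσ⟩ := exists_equiv (hs x) ha hx
    obtain ⟨τ, hτ⟩ := exists_equiv (hs y) hb hy
    refine ⟨(x, σ.symm.comp τ, y), Subtype.ext (Subtype.ext ?_)⟩
    change T.typeOf (Sum.elim (s x) (σ.symm.comp τ ∘ s y)) = T.typeOf (Sum.elim a b)
    rw [← typeOf_sumElim_comp_equiv σ]
    congr 2
    · exact funext hσ
    · funext i
      simp [hτ]

variable [TopologicalSpace B]

theorem continuous_ofTrivial (hs : ∀ x, Function.Surjective (s x)) (hH : ∀ x, IsHenkin Φ (s x))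
    (hloc : ∀ n x, ∀ᶠ y in 𝓝 x, s y n = s x n) : Continuous (ofTrivial (T := T) hs hH) := by
  refine Continuous.subtype_mk (Continuous.subtype_mk (continuous_iff_continuousAt.2 ?_) _) _
  intro p U hU
  obtain ⟨φ, h1, h2⟩ := exists_formula_of_mem_nhds hU
  obtain ⟨F, hF⟩ := exists_finset_realize_congr M φ
  have hc1 : Continuous fun q : Trivial B (M ≃[L] M) => q.1 :=
    continuous_fst (X := B) (Y := (M ≃[L] M) × B)
  have hc2 : Continuous fun q : Trivial B (M ≃[L] M) => q.2.1 :=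
    continuous_fst.comp (continuous_snd (X := B) (Y := (M ≃[L] M) × B))
  have hc3 : Continuous fun q : Trivial B (M ≃[L] M) => q.2.2 :=
    continuous_snd.comp (continuous_snd (X := B) (Y := (M ≃[L] M) × B))
  have key : ∀ᶠ q : Trivial B (M ≃[L] M) in 𝓝 p, ∀ i ∈ F,
      Sum.elim (s q.1) (q.2.1 ∘ s q.2.2) i = Sum.elim (s p.1) (p.2.1 ∘ s p.2.2) i := by
    refine (Filter.eventually_all_finset F).2 fun i _ => ?_
    cases i with
    | inl n => exact hc1.continuousAt.eventually (hloc n p.1)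
    | inr n =>
      filter_upwards [hc3.continuousAt.eventually (hloc n p.2.2),
        hc2.continuousAt.eventually (Aut.eventually_apply_eq p.2.1 (s p.2.2 n))] with q hq1 hq2
      simp only [Sum.elim_inr, Function.comp_apply, hq1, hq2]
  refine mem_map.2 ?_
  filter_upwards [key] with q hq
  exact h2 _ (Theory.CompleteType.formula_mem_typeOf.2
    ((hF _ _ hq).2 (Theory.CompleteType.formula_mem_typeOf.1 h1)))

/-- If `g = tp(s x, σ (s y))`, then the types of `s x` and `s y`, hence `x` and `y`, depend
continuously on `g`.  If moreover `m = s y j` and `σ m = s x i`, then the equation `xᵢ = yⱼ` belongs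
to `g`, and this together with the values `s x i` and `s y j` determines `σ m`. -/
theorem continuous_of_ofTrivial_apply (hs : ∀ x, Function.Surjective (s x))
    (hH : ∀ x, IsHenkin Φ (s x)) (hloc : ∀ n x, ∀ᶠ y in 𝓝 x, s y n = s x n)
    {κ : henkinTypes T Φ → B} (hκ : Continuous κ)
    (hκs : ∀ x, κ ⟨T.typeOf (s x), typeOf_mem_henkinTypes.2 (hH x)⟩ = x)
    {e : GPhi T Φ → Trivial B (M ≃[L] M)} (he : ∀ g, ofTrivial hs hH (e g) = g) :
    Continuous e := by
  have hmem : ∀ (g : GPhi T Φ) (φ : L.Formula (ℕ ⊕ ℕ)), Formula.equivSentence φ ∈ g.1.1 ↔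
      φ.Realize (Sum.elim (s (e g).1) ((e g).2.1 ∘ s (e g).2.2)) := by
    intro g φ
    conv_lhs => rw [← he g]
    exact Theory.CompleteType.formula_mem_typeOf
  have hev : ∀ (g : GPhi T Φ) (φ : L.Formula (ℕ ⊕ ℕ)),
      φ.Realize (Sum.elim (s (e g).1) ((e g).2.1 ∘ s (e g).2.2)) →
      ∀ᶠ h in 𝓝 g, φ.Realize (Sum.elim (s (e h).1) ((e h).2.1 ∘ s (e h).2.2)) := by
    intro g φ hφ
    have hc : Continuous fun h : GPhi T Φ => h.1.1 :=
      continuous_subtype_val.comp continuous_subtype_val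
    filter_upwards [hc.continuousAt.eventually (eventually_formula_mem ((hmem g φ).2 hφ))] with h hh
    exact (hmem h φ).1 hh
  have hcont : ∀ (f : GPhi T Φ → B), (∀ g (φ : L.Formula ℕ), φ.Realize (s (f g)) →
      ∀ᶠ h in 𝓝 g, φ.Realize (s (f h))) → Continuous f := by
    intro f hf
    have h1 : Continuous fun g => (⟨T.typeOf (s (f g)), typeOf_mem_henkinTypes.2 (hH _)⟩ :
        henkinTypes T Φ) := by
      refine Continuous.subtype_mk (continuous_iff_continuousAt.2 fun g U hU => ?_) _
      obtain ⟨φ, h1, h2⟩ := exists_formula_of_mem_nhds hU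
      refine mem_map.2 ?_
      filter_upwards [hf g φ (Theory.CompleteType.formula_mem_typeOf.1 h1)] with h hh
      exact h2 _ (Theory.CompleteType.formula_mem_typeOf.2 hh)
    exact (hκ.comp h1).congr fun g => hκs (f g)
  have hc1 : Continuous fun g => (e g).1 := by
    refine hcont _ fun g φ hφ => ?_
    have h1 : ∀ h, (φ.relabel Sum.inl).Realize
        (Sum.elim (s (e h).1) ((e h).2.1 ∘ s (e h).2.2)) ↔ φ.Realize (s (e h).1) := by
      intro h
      rw [Formula.realize_relabel, Sum.elim_comp_inl]
    filter_upwards [hev g _ ((h1 g).2 hφ)] with h hh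
    exact (h1 h).1 hh
  have hc3 : Continuous fun g => (e g).2.2 := by
    refine hcont _ fun g φ hφ => ?_
    have h1 : ∀ h, (φ.relabel Sum.inr).Realize
        (Sum.elim (s (e h).1) ((e h).2.1 ∘ s (e h).2.2)) ↔ φ.Realize (s (e h).2.2) := by
      intro h
      rw [Formula.realize_relabel, Sum.elim_comp_inr]
      exact StrongHomClass.realize_formula (e h).2.1 φ
    filter_upwards [hev g _ ((h1 g).2 hφ)] with h hh
    exact (h1 h).1 hh
  have hc2 : Continuous fun g => (e g).2.1 := by
    refine Aut.continuous_of_eventually fun m g => ?_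
    obtain ⟨j, rfl⟩ := hs (e g).2.2 m
    obtain ⟨i, hi⟩ := hs (e g).1 ((e g).2.1 (s (e g).2.2 j))
    filter_upwards [hc1.continuousAt.eventually (hloc i (e g).1),
      hc3.continuousAt.eventually (hloc j (e g).2.2),
      hev g (Term.equal (Term.var (.inl i)) (Term.var (.inr j))) (by simpa using hi)]
      with h h1 h2 h3
    have h3 : s (e h).1 i = (e h).2.1 (s (e h).2.2 j) := by simpa using h3
    rw [← hi, ← h1, h3, h2]
  exact hc1.prodMk (hc2.prodMk hc3)

end Isomorphism

theorem nonempty_topIso_trivial_cantor {T : L.Theory} {Φ : ∀ n : ℕ, L.Formula (Fin n ⊕ Unit)}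
    [Countable L.Symbols] (hT : T.IsComplete)
    (hcat : Cardinal.Categorical Cardinal.aleph0.{0} T) (M : Type w) [L.Structure M] [M ⊨ T]
    [Countable M] [Nontrivial M] (hΦ : IsRich Φ) :
    Nonempty (TopIso (GPhi T Φ) (Trivial (ℕ → Bool) (M ≃[L] M))) := by
  have hM : ∀ p ∈ henkinTypes T Φ, ∃ b : ℕ → M, Function.Surjective b ∧ T.typeOf b = p :=
    fun p hp => exists_surjective_of_mem_henkinTypes hT hcat M hΦ hp
  obtain ⟨κ⟩ := nonempty_henkinTypes_homeomorph_cantor hΦ hM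
  obtain ⟨r, hr, hrp, hrloc⟩ := exists_continuous_enumeration hΦ hM
  let s : (ℕ → Bool) → ℕ → M := fun x => r (κ.symm x)
  have hs : ∀ x, Function.Surjective (s x) := fun x => hr _
  have hsp : ∀ x, T.typeOf (s x) = κ.symm x := fun x => hrp _
  have hH : ∀ x, IsHenkin Φ (s x) := fun x =>
    typeOf_mem_henkinTypes.1 (by rw [hsp]; exact (κ.symm x).2)
  have hinj : ∀ x y, T.typeOf (s x) = T.typeOf (s y) → x = y := fun x y h =>
    κ.symm.injective (Subtype.ext (by rw [← hsp, ← hsp, h]))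
  have hsurj : ∀ p ∈ henkinTypes T Φ, ∃ x, T.typeOf (s x) = p := fun p hp =>
    ⟨κ ⟨p, hp⟩, by rw [hsp, κ.symm_apply_apply]⟩
  have hloc : ∀ n x, ∀ᶠ y in 𝓝 x, s y n = s x n := fun n x =>
    κ.symm.continuous.continuousAt.eventually (hrloc n (κ.symm x))
  have hbij := bijective_ofTrivial hs hH hinj hsurj fun N _ =>
    nonempty_equiv_of_countable hT hcat M N
  let E := Equiv.ofBijective _ hbij
  have hE : ∀ p, E p = ofTrivial hs hH p := fun _ => rfl
  have hcont : Continuous E.symm := continuous_of_ofTrivial_apply hs hH hloc κ.continuous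
    (fun x => by
      rw [← κ.eq_symm_apply]
      exact Subtype.ext (hsp x)) (fun g => E.apply_symm_apply g)
  refine ⟨{ E.symm with
    continuous_toFun := hcont
    continuous_invFun := continuous_ofTrivial hs hH hloc
    map_mul' := fun f g => ?_ }⟩
  obtain ⟨p, rfl⟩ := E.surjective f
  obtain ⟨q, rfl⟩ := E.surjective g
  change (pmul (E p) (E q)).map E.symm = pmul (E.symm (E p)) (E.symm (E q))
  rw [E.symm_apply_apply, E.symm_apply_apply, hE, hE, pmul_ofTrivial hs hH hinj, Part.map_map]
  exact (congrArg (fun k => (pmul p q).map k) (funext E.symm_apply_apply)).trans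
    (Part.map_id' (fun _ => rfl) _)

end TheoryGroupoid

theorem mainTheorem6 {L : FirstOrder.Language.{u, v}} [Countable L.Symbols] (T : L.Theory)
    (hT : T.IsComplete) (hcat : Cardinal.Categorical Cardinal.aleph0.{0} T)
    (M : Type w) [L.Structure M] [M ⊨ T] [Countable M] [Nontrivial M]
    (Φ : ∀ n : ℕ, L.Formula (Fin n ⊕ Unit)) (hΦ : TheoryGroupoid.IsRich Φ) :
    PartialGroupoid.IsTopological (TheoryGroupoid.GPhi T Φ) ∧
    PartialGroupoid.IsTopological (PartialGroupoid.Trivial (ℕ → Bool) (M ≃[L] M)) ∧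
    Nonempty (PartialGroupoid.TopIso (TheoryGroupoid.GPhi T Φ)
      (PartialGroupoid.Trivial (ℕ → Bool) (M ≃[L] M))) := by
  have htriv : PartialGroupoid.IsTopological (PartialGroupoid.Trivial (ℕ → Bool) (M ≃[L] M)) :=
    PartialGroupoid.Trivial.isTopological
  obtain ⟨e⟩ := TheoryGroupoid.nonempty_topIso_trivial_cantor hT hcat M hΦ
  exact ⟨e.isTopological, htriv, ⟨e⟩⟩
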